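/- Let $\Delta>0$, and let $X=(X_n)_{n\ge 0}$ be the linearly edge-reinforced random walk on $\mathbb{Z}_+=\{0,1,2,\ldots\}$ with reinforcement parameter $\Delta$ and initial weights $x\vee 1$ (the critical case $\alpha=1$ of the weights $x^{\alpha}\vee 1$). That is, $X_0=0$ almost surely, and, with $\phi_n(x)$ the number of $k\in\{1,\ldots,n\}$ such that $\{X_{k-1},X_k\}=\{x,x+1\}$, and with weights $w_n(x)=(x\vee 1)+\Delta\,\phi_n(x)$ for $x\in\mathbb{Z}_+$ and $w_n(-1)=0$, $$P(X_{n+1}=X_n+1\mid X_0,\ldots,X_n)=1-P(X_{n+1}=X_n-1\mid X_0,\ldots,X_n)=\frac{w_n(X_n)}{w_n(X_n-1)+w_n(X_n)}\qquad(n\ge 0).$$ (i) If $\Delta>2$, then for every $\varepsilon>0$, almost surely, $$\limsup_{n\to\infty}\frac{X_n}{n^{(1-\varepsilon)/\Delta}}=+\infty\quad\text{and}\quad\lim_{n\to\infty}\frac{X_n}{n^{(1+\varepsilon)/\Delta}}=0.$$ (ii) If $0<\Delta\le 2$, then for every $\varepsilon>0$, almost surely, $$\limsup_{n\to\infty}\frac{X_n}{n^{(1-\varepsilon)/2}}=+\infty\quad\text{and}\quad\lim_{n\to\infty}\frac{X_n}{n^{(1+\varepsilon)/2}}=0.$$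 -/

import Mathlib

noncomputable section

namespace LERRW

open MeasureTheory

/-- The number of traversals of the (undirected) edge `{x, x + 1}` by time `n` along the path
`i 0, i 1, i 2, …`. It depends only on `i 0, …, i n`. -/
def traversals (i : ℕ → ℕ) (n x : ℕ) : ℕ :=
  ((Finset.range n).filter fun k => s(i k, i (k + 1)) = s(x, x + 1)).card

/-- The weight at time `n` of the edge `{x, x + 1}`, for the reinforcement scheme `f`
(`f ℓ x` is the weight of `{x, x + 1}` after `ℓ` traversals) and the path `i`. -/
def weight (f : ℕ → ℕ → ℝ) (i : ℕ → ℕ) (n x : ℕ) : ℝ :=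
  f (traversals i n x) x

/-- The weight at time `n` of the edge `{x - 1, x}`; it is `0` for `x = 0`
(reflection at the origin). -/
def leftWeight (f : ℕ → ℕ → ℝ) (i : ℕ → ℕ) (n : ℕ) : ℕ → ℝ
  | 0 => 0
  | x + 1 => weight f i n x

/-- The probability of a step to the right at time `n`, given the history `i 0, …, i n`. -/
def upProb (f : ℕ → ℕ → ℝ) (i : ℕ → ℕ) (n : ℕ) : ℝ :=
  weight f i n (i n) / (leftWeight f i n (i n) + weight f i n (i n))

/-- The process `X` on the probability space `(Ω, P)` is the edge-reinforced random walk on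
`{0, 1, 2, …}` started at `0` with the reinforcement scheme `f` (positive, and nondecreasing in
the number of traversals). The conditional probabilities given `X 0, …, X n` are the elementary
ones, given each history `i 0, …, i n` of positive probability. -/
structure IsERRW {Ω : Type*} [MeasurableSpace Ω] (P : Measure Ω)
    (f : ℕ → ℕ → ℝ) (X : ℕ → Ω → ℕ) : Prop where
  measurable : ∀ n, Measurable (X n)
  start : P {ω | X 0 ω = 0} = 1
  step_up : ∀ (n : ℕ) (i : ℕ → ℕ), P {ω | ∀ k ≤ n, X k ω = i k} ≠ 0 →
    ProbabilityTheory.cond P {ω | ∀ k ≤ n, X k ω = i k} {ω | X (n + 1) ω = X n ω + 1}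
      = ENNReal.ofReal (upProb f i n)
  step_down : ∀ (n : ℕ) (i : ℕ → ℕ), P {ω | ∀ k ≤ n, X k ω = i k} ≠ 0 →
    ProbabilityTheory.cond P {ω | ∀ k ≤ n, X k ω = i k} {ω | X (n + 1) ω + 1 = X n ω}
      = ENNReal.ofReal (1 - upProb f i n)

/-- The linear reinforcement scheme with initial weights `w₀` and reinforcement parameter `Δ`. -/
def linearScheme (w₀ : ℕ → ℝ) (Δ : ℝ) (ℓ x : ℕ) : ℝ :=
  w₀ x + ℓ * Δ

/-- The initial weights: `1` for the edge `{0, 1}` and `x ^ α` for `{x, x + 1}` with `x ≥ 1`. -/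
def powerWeight (α : ℝ) (x : ℕ) : ℝ :=
  if x = 0 then 1 else (x : ℝ) ^ α

/-- The process `X` on `(Ω, P)` is the linearly edge-reinforced random walk on `{0, 1, 2, …}`
started at `0`, with the initial weights `powerWeight α` and reinforcement parameter `Δ`. -/
def IsLERRW {Ω : Type*} [MeasurableSpace Ω] (P : Measure Ω) (α Δ : ℝ) (X : ℕ → Ω → ℕ) : Prop :=
  IsERRW P (linearScheme (powerWeight α) Δ) X

end LERRW

end

/-! Whenever the walk is at a site `y ≥ 1`, it has crossed the edge to its right an even number of
times and the edge to its left an odd number of times. Successive departures from `y` are therefore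
draws from a Pólya urn with initial weights `w y` and `w (y - 1) + Δ` and increment `2 * Δ`, and the
urns of different sites are independent. Since the Beta law is conjugate to such draws, the
reinforced walk is a mixture of nearest-neighbour walks in a random environment `p` with independent
step probabilities of law Beta(`w y / (2Δ)`, `(w (y - 1) + Δ) / (2Δ)`), reflected at `0`
(`measureReal_path_eq_integral`).

In a fixed environment let `T x` be the mean time from `0` to `x` (`hitTime`). Then `T (X n) - n` is
a martingale, so level `x` is reached within `n` steps with probability at most `n / T x` and missed
with probability at most `T x / n`. Growth of the walk is thus read off from growth of `T`. In terms
of the potential `V`, the mean time from `y` to `y + 1` is comparable to the sum over `z ≤ y` of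
`exp (V y - V z)`.

At site `u`, `p u - 1/2` has mean `-(Δ - 1) / (4u) + O(u⁻²)` and variance `O(1/u)`, while an
increment of `V` is `-4 (p u - 1/2)` up to a summable error. Hence `V y` has drift `(Δ - 1) log y`,
and its fluctuations, of variance `O(log y)`, are almost surely `o(log y)` (`ae_logPotential`). So
`T x = x ^ (max Δ 2 + o(1))` (`hitTime_le`, `hitTime_ge`); the transition at `Δ = 2` is that between
divergence and convergence of the series of `z ^ (-(Δ - 1))`.

For `s > max Δ 2` the probability of missing `x` by time `x ^ s` tends to `0`, so infinitely many
levels are reached in time. For `s < max Δ 2` the quenched probabilities of reaching `2 ^ (k + 1)`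
by time `2 ^ (k * s)` are summable, and a Borel–Cantelli argument applies. -/

namespace LERRW

open MeasureTheory ProbabilityTheory Filter Topology

/-! ### Path probabilities of the reinforced walk -/

section Walk

/-- The continuation of a path up to time `m` by a step to the right. -/
def stepUp (i : ℕ → ℕ) (m : ℕ) : ℕ → ℕ := Function.update i (m + 1) (i m + 1)

/-- The continuation of a path up to time `m` by a step to the left. -/
def stepDown (i : ℕ → ℕ) (m : ℕ) : ℕ → ℕ := Function.update i (m + 1) (i m - 1)

/-- The expectation of `φ` over `n` further steps of the nearest-neighbour process that has
followed the path `i` up to time `m`, where `q i m` is the probability of a step to the right. -/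
def pathMean (q : (ℕ → ℕ) → ℕ → ℝ) (φ : (ℕ → ℕ) → ℝ) : ℕ → ℕ → (ℕ → ℕ) → ℝ
  | 0, _, i => φ i
  | n + 1, m, i => q i m * pathMean q φ n (m + 1) (stepUp i m)
      + (1 - q i m) * pathMean q φ n (m + 1) (stepDown i m)

/-- Membership in `A` depends only on the path up to time `N`. -/
def DependsUpTo (A : Set (ℕ → ℕ)) (N : ℕ) : Prop :=
  ∀ i j : ℕ → ℕ, (∀ k ≤ N, i k = j k) → i ∈ A → j ∈ A

lemma stepUp_of_le (i : ℕ → ℕ) {m k : ℕ} (h : k ≤ m) : stepUp i m k = i k :=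
  Function.update_of_ne (by omega) _ _

lemma stepDown_of_le (i : ℕ → ℕ) {m k : ℕ} (h : k ≤ m) : stepDown i m k = i k :=
  Function.update_of_ne (by omega) _ _

@[simp] lemma stepUp_succ (i : ℕ → ℕ) (m : ℕ) : stepUp i m (m + 1) = i m + 1 :=
  Function.update_self _ _ _

@[simp] lemma stepDown_succ (i : ℕ → ℕ) (m : ℕ) : stepDown i m (m + 1) = i m - 1 :=
  Function.update_self _ _ _

variable {Ω : Type*} [MeasurableSpace Ω]

/-- The event that the process follows the path `i` up to time `m`. -/
def follows (X : ℕ → Ω → ℕ) (i : ℕ → ℕ) (m : ℕ) : Set Ω := {ω | ∀ k ≤ m, X k ω = i k}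

lemma measurableSet_follows {X : ℕ → Ω → ℕ} (hX : ∀ n, Measurable (X n)) (i : ℕ → ℕ) (m : ℕ) :
    MeasurableSet (follows X i m) := by
  have : follows X i m = ⋂ k, ⋂ (_ : k ≤ m), X k ⁻¹' {i k} := by
    ext; simp [follows]
  rw [this]
  exact MeasurableSet.iInter fun k => MeasurableSet.iInter fun _ =>
    hX k (measurableSet_singleton _)

lemma measurableSet_path {X : ℕ → Ω → ℕ} (hX : ∀ n, Measurable (X n)) {A : Set (ℕ → ℕ)}
    {N : ℕ} (hA : DependsUpTo A N) : MeasurableSet {ω | (fun n => X n ω) ∈ A} := by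
  have h : {ω | (fun n => X n ω) ∈ A} = (fun ω (k : Fin (N + 1)) => X k ω) ⁻¹'
      {j | ∃ i ∈ A, ∀ k : Fin (N + 1), i k = j k} := by
    ext ω
    simp only [Set.mem_ofPred_eq, Set.mem_preimage]
    constructor
    · exact fun h => ⟨_, h, fun k => rfl⟩
    · rintro ⟨i, hi, h⟩
      exact hA i _ (fun k hk => h ⟨k, by omega⟩) hi
  rw [h]
  have hm : Measurable fun ω (k : Fin (N + 1)) => X k ω := measurable_pi_lambda _ fun k => hX k
  exact hm (Set.to_countable _).measurableSet

lemma upProb_zero {f : ℕ → ℕ → ℝ} (hf : ∀ l x, 0 < f l x) {i : ℕ → ℕ} {m : ℕ} (h : i m = 0) :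
    upProb f i m = 1 := by
  simp [upProb, h, leftWeight, weight, (hf _ _).ne']

lemma upProb_mem_Icc {f : ℕ → ℕ → ℝ} (hf : ∀ l x, 0 < f l x) (i : ℕ → ℕ) (m : ℕ) :
    upProb f i m ∈ Set.Icc (0 : ℝ) 1 := by
  have h1 : 0 < weight f i m (i m) := hf _ _
  have h2 : 0 ≤ leftWeight f i m (i m) := by
    cases i m with
    | zero => simp [leftWeight]
    | succ x => exact (hf _ _).le
  unfold upProb
  exact ⟨by positivity, by rw [div_le_one (by positivity)]; linarith⟩

variable {P : Measure Ω} [IsProbabilityMeasure P] {f : ℕ → ℕ → ℝ} {X : ℕ → Ω → ℕ}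

lemma IsERRW.measureReal_stepUp (hX : IsERRW P f X) (hf : ∀ l x, 0 < f l x) (i : ℕ → ℕ) (m : ℕ) :
    P.real (follows X (stepUp i m) (m + 1)) = P.real (follows X i m) * upProb f i m := by
  have hset : follows X (stepUp i m) (m + 1)
      = follows X i m ∩ {ω | X (m + 1) ω = X m ω + 1} := by
    ext ω
    simp only [follows, Set.mem_ofPred_eq, Set.mem_inter_iff]
    constructor
    · intro h
      have h1 : ∀ k ≤ m, X k ω = i k := fun k hk => by
        rw [h k (by omega), stepUp_of_le i hk]
      exact ⟨h1, by rw [h _ le_rfl, stepUp_succ, h1 m le_rfl]⟩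
    · rintro ⟨h1, h2⟩ k hk
      rcases Nat.le_succ_iff.1 hk with hk | rfl
      · rw [h1 k hk, stepUp_of_le i hk]
      · rw [stepUp_succ, h2, h1 m le_rfl]
  by_cases h0 : P (follows X i m) = 0
  · have : P (follows X (stepUp i m) (m + 1)) = 0 :=
      measure_mono_null (hset ▸ Set.inter_subset_left) h0
    simp [measureReal_def, this, h0]
  · have h := hX.step_up m i h0
    change cond P (follows X i m) _ = _ at h
    rw [cond_apply (measurableSet_follows hX.measurable i m)] at h
    change (P (follows X i m))⁻¹ * P (follows X i m ∩ _) = _ at h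
    rw [← hset] at h
    have h' : P (follows X (stepUp i m) (m + 1))
        = P (follows X i m) * ENNReal.ofReal (upProb f i m) := by
      rw [← h, ← mul_assoc, ENNReal.mul_inv_cancel h0 (measure_ne_top _ _), one_mul]
    rw [measureReal_def, h', ENNReal.toReal_mul, ENNReal.toReal_ofReal (upProb_mem_Icc hf i m).1,
      measureReal_def]

lemma IsERRW.measureReal_stepDown (hX : IsERRW P f X) (hf : ∀ l x, 0 < f l x) (i : ℕ → ℕ)
    (m : ℕ) (hi : i m ≠ 0) :
    P.real (follows X (stepDown i m) (m + 1)) = P.real (follows X i m) * (1 - upProb f i m) := by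
  have hset : follows X (stepDown i m) (m + 1)
      = follows X i m ∩ {ω | X (m + 1) ω + 1 = X m ω} := by
    ext ω
    simp only [follows, Set.mem_ofPred_eq, Set.mem_inter_iff]
    constructor
    · intro h
      have h1 : ∀ k ≤ m, X k ω = i k := fun k hk => by
        rw [h k (by omega), stepDown_of_le i hk]
      exact ⟨h1, by rw [h _ le_rfl, stepDown_succ, h1 m le_rfl]; exact Nat.sub_add_cancel (Nat.pos_of_ne_zero hi)⟩
    · rintro ⟨h1, h2⟩ k hk
      rcases Nat.le_succ_iff.1 hk with hk | rfl
      · rw [h1 k hk, stepDown_of_le i hk]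
      · rw [stepDown_succ, ← h1 m le_rfl, ← h2]; rfl
  by_cases h0 : P (follows X i m) = 0
  · have : P (follows X (stepDown i m) (m + 1)) = 0 :=
      measure_mono_null (hset ▸ Set.inter_subset_left) h0
    simp [measureReal_def, this, h0]
  · have h := hX.step_down m i h0
    change cond P (follows X i m) _ = _ at h
    rw [cond_apply (measurableSet_follows hX.measurable i m)] at h
    change (P (follows X i m))⁻¹ * P (follows X i m ∩ _) = _ at h
    rw [← hset] at h
    have h' : P (follows X (stepDown i m) (m + 1))
        = P (follows X i m) * ENNReal.ofReal (1 - upProb f i m) := by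
      rw [← h, ← mul_assoc, ENNReal.mul_inv_cancel h0 (measure_ne_top _ _), one_mul]
    rw [measureReal_def, h', ENNReal.toReal_mul,
      ENNReal.toReal_ofReal (by linarith [(upProb_mem_Icc hf i m).2]), measureReal_def]

lemma follows_step_subset {Ω : Type*} {X : ℕ → Ω → ℕ} (i j : ℕ → ℕ) (m : ℕ) (h : ∀ k ≤ m, j k = i k) :
    follows X j (m + 1) ⊆ follows X i m := fun ω hω k hk => by
  rw [hω k (by omega), h k hk]

/-- Induction on the number `n` of remaining steps: given the history, the two continuations have
total conditional probability one, so anything else is a null event. -/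
lemma IsERRW.measureReal_inter_path (hX : IsERRW P f X) (hf : ∀ l x, 0 < f l x)
    {A : Set (ℕ → ℕ)} {N : ℕ} (hA : DependsUpTo A N) (n : ℕ) :
    ∀ (m : ℕ) (i : ℕ → ℕ), m + n = N →
      P.real (follows X i m ∩ {ω | (fun k => X k ω) ∈ A})
        = P.real (follows X i m) * pathMean (upProb f) (A.indicator 1) n m i := by
  induction n with
  | zero =>
    rintro m i rfl
    by_cases hi : i ∈ A
    · have : follows X i m ∩ {ω | (fun k => X k ω) ∈ A} = follows X i m :=
        Set.inter_eq_left.2 fun ω hω => hA i _ (fun k hk => (hω k hk).symm) hi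
      simp [this, pathMean, hi]
    · have : follows X i m ∩ {ω | (fun k => X k ω) ∈ A} = ∅ := by
        ext ω
        simp only [Set.mem_inter_iff, Set.mem_ofPred_eq, Set.mem_empty_iff_false, iff_false, not_and]
        exact fun hω h => hi (hA _ i (fun k hk => hω k hk) h)
      simp [this, pathMean, hi]
  | succ n ih =>
    intro m i hm
    set B := {ω | (fun k => X k ω) ∈ A} with hB
    have mB : MeasurableSet B := measurableSet_path hX.measurable hA
    have mF := measurableSet_follows hX.measurable
    have hu := follows_step_subset (X := X) i (stepUp i m) m fun k hk => stepUp_of_le i hk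
    have hup := hX.measureReal_stepUp hf i m
    rw [pathMean]
    -- At the origin `stepDown` stays put by truncated subtraction, but its coefficient `1 - upProb`
    -- is zero.
    by_cases hi : i m = 0
    · have hae : P.real (follows X i m \ follows X (stepUp i m) (m + 1)) = 0 := by
        rw [measureReal_sdiff hu (mF _ _), hup, upProb_zero hf hi]; ring
      have h1 : P.real (follows X i m ∩ B) = P.real (follows X (stepUp i m) (m + 1) ∩ B) := by
        refine le_antisymm ?_ (measureReal_mono (Set.inter_subset_inter_left _ hu))
        calc P.real (follows X i m ∩ B) ≤ P.real ((follows X (stepUp i m) (m + 1) ∩ B) ∪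
              (follows X i m \ follows X (stepUp i m) (m + 1))) :=
              measureReal_mono fun ω hω => by
                by_cases h : ω ∈ follows X (stepUp i m) (m + 1)
                · exact Or.inl ⟨h, hω.2⟩
                · exact Or.inr ⟨hω.1, h⟩
          _ ≤ _ := (measureReal_union_le _ _).trans (by rw [hae, add_zero])
      rw [h1, ih _ _ (by omega), hup, upProb_zero hf hi]
      ring
    · have hd := follows_step_subset (X := X) i (stepDown i m) m fun k hk => stepDown_of_le i hk
      have hdn := hX.measureReal_stepDown hf i m hi
      have hdisj : Disjoint (follows X (stepUp i m) (m + 1)) (follows X (stepDown i m) (m + 1)) := by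
        refine Set.disjoint_left.2 fun ω h1 h2 => ?_
        have := (h1 _ le_rfl).symm.trans (h2 _ le_rfl)
        rw [stepUp_succ, stepDown_succ] at this
        omega
      set U := follows X (stepUp i m) (m + 1) with hU
      set D := follows X (stepDown i m) (m + 1) with hD
      have hae : P.real (follows X i m \ (U ∪ D)) = 0 := by
        rw [measureReal_sdiff (Set.union_subset hu hd) ((mF _ _).union (mF _ _)),
          measureReal_union hdisj (mF _ _), hup, hdn]
        ring
      have h1 : P.real (follows X i m ∩ B) = P.real ((U ∩ B) ∪ (D ∩ B)) := by
        refine le_antisymm ?_ (measureReal_mono (Set.union_subset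
          (Set.inter_subset_inter_left _ hu) (Set.inter_subset_inter_left _ hd)))
        calc P.real (follows X i m ∩ B) ≤ P.real (((U ∩ B) ∪ (D ∩ B)) ∪
              (follows X i m \ (U ∪ D))) :=
              measureReal_mono fun ω hω => by
                by_cases h : ω ∈ U
                · exact Or.inl (Or.inl ⟨h, hω.2⟩)
                by_cases h' : ω ∈ D
                · exact Or.inl (Or.inr ⟨h', hω.2⟩)
                · exact Or.inr ⟨hω.1, by simp [h, h']⟩
          _ ≤ _ := (measureReal_union_le _ _).trans (by rw [hae, add_zero])
      rw [h1, measureReal_union (hdisj.mono Set.inter_subset_left Set.inter_subset_left)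
        ((mF _ _).inter mB), ih _ _ (by omega), ih _ _ (by omega), hup, hdn]
      ring

/-- The probability of an event determined by the first `N` steps is a finite path sum. -/
lemma IsERRW.measureReal_path (hX : IsERRW P f X) (hf : ∀ l x, 0 < f l x)
    {A : Set (ℕ → ℕ)} {N : ℕ} (hA : DependsUpTo A N) :
    P.real {ω | (fun k => X k ω) ∈ A} = pathMean (upProb f) (A.indicator 1) N 0 0 := by
  have hs : follows X 0 0 = {ω | X 0 ω = 0} := by
    ext ω; simp [follows]
  have h1 : P (follows X 0 0) = 1 := hs ▸ hX.start
  have h2 : P.real (follows X 0 0) = 1 := by simp [measureReal_def, h1]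
  have h := hX.measureReal_inter_path hf hA N 0 0 (by omega)
  rw [h2, one_mul] at h
  rw [← h]
  have h3 : P (follows X 0 0)ᶜ = 0 :=
    (prob_compl_eq_zero_iff (measurableSet_follows hX.measurable _ _)).2 h1
  refine le_antisymm ?_ (measureReal_mono Set.inter_subset_right)
  calc P.real {ω | (fun k => X k ω) ∈ A} ≤ P.real ((follows X 0 0 ∩ {ω | (fun k => X k ω) ∈ A}) ∪
        (follows X 0 0)ᶜ) := measureReal_mono fun ω hω => by
          by_cases h : ω ∈ follows X 0 0
          · exact Or.inl ⟨h, hω⟩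
          · exact Or.inr h
    _ ≤ _ := (measureReal_union_le _ _).trans (by simp [measureReal_def, h3])

end Walk

/-! ### Step counts and edge traversals of a nearest-neighbour path -/

/-- The path `i` takes nearest-neighbour steps in `ℕ` from `0` up to time `m`. -/
def IsPath (i : ℕ → ℕ) (m : ℕ) : Prop :=
  i 0 = 0 ∧ ∀ k < m, i (k + 1) = i k + 1 ∨ i (k + 1) + 1 = i k

/-- The number of steps from `x` to `x + 1` up to time `m`. -/
def upSteps (i : ℕ → ℕ) (m x : ℕ) : ℕ :=
  ∑ k ∈ Finset.range m, if i k = x ∧ i (k + 1) = x + 1 then 1 else 0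

/-- The number of steps from `x` to `x - 1` up to time `m`. -/
def downSteps (i : ℕ → ℕ) (m x : ℕ) : ℕ :=
  ∑ k ∈ Finset.range m, if i k = x ∧ i (k + 1) + 1 = x then 1 else 0

lemma upSteps_congr {i j : ℕ → ℕ} {m : ℕ} (h : ∀ k ≤ m, i k = j k) (x : ℕ) :
    upSteps i m x = upSteps j m x :=
  Finset.sum_congr rfl fun k hk => by
    have := Finset.mem_range.1 hk
    rw [h k (by omega), h (k + 1) (by omega)]

lemma downSteps_congr {i j : ℕ → ℕ} {m : ℕ} (h : ∀ k ≤ m, i k = j k) (x : ℕ) :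
    downSteps i m x = downSteps j m x :=
  Finset.sum_congr rfl fun k hk => by
    have := Finset.mem_range.1 hk
    rw [h k (by omega), h (k + 1) (by omega)]

lemma upSteps_stepUp (i : ℕ → ℕ) (m x : ℕ) :
    upSteps (stepUp i m) (m + 1) x = upSteps i m x + if x = i m then 1 else 0 := by
  rw [upSteps, Finset.sum_range_succ, ← upSteps,
    upSteps_congr (fun k hk => stepUp_of_le i hk), stepUp_succ, stepUp_of_le i le_rfl]
  congr 1
  by_cases h : x = i m
  · simp [h]
  · rw [if_neg (by omega), if_neg h]

lemma downSteps_stepUp (i : ℕ → ℕ) (m x : ℕ) :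
    downSteps (stepUp i m) (m + 1) x = downSteps i m x := by
  rw [downSteps, Finset.sum_range_succ, ← downSteps,
    downSteps_congr (fun k hk => stepUp_of_le i hk), stepUp_succ, stepUp_of_le i le_rfl,
    if_neg (by omega), add_zero]

lemma upSteps_stepDown (i : ℕ → ℕ) (m x : ℕ) :
    upSteps (stepDown i m) (m + 1) x = upSteps i m x := by
  rw [upSteps, Finset.sum_range_succ, ← upSteps,
    upSteps_congr (fun k hk => stepDown_of_le i hk), stepDown_succ, stepDown_of_le i le_rfl,
    if_neg (by omega), add_zero]

lemma downSteps_stepDown (i : ℕ → ℕ) {m : ℕ} (hi : i m ≠ 0) (x : ℕ) :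
    downSteps (stepDown i m) (m + 1) x = downSteps i m x + if x = i m then 1 else 0 := by
  rw [downSteps, Finset.sum_range_succ, ← downSteps,
    downSteps_congr (fun k hk => stepDown_of_le i hk), stepDown_succ, stepDown_of_le i le_rfl]
  congr 1
  by_cases h : x = i m
  · rw [if_pos (by omega), if_pos h]
  · rw [if_neg (by omega), if_neg h]

lemma IsPath.stepUp {i : ℕ → ℕ} {m : ℕ} (h : IsPath i m) : IsPath (stepUp i m) (m + 1) := by
  refine ⟨by rw [stepUp_of_le i (Nat.zero_le _), h.1], fun k hk => ?_⟩
  rcases Nat.lt_succ_iff_lt_or_eq.1 hk with hk | rfl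
  · rw [stepUp_of_le i hk, stepUp_of_le i hk.le]; exact h.2 k hk
  · rw [stepUp_succ, stepUp_of_le i le_rfl]; exact Or.inl rfl

lemma IsPath.stepDown {i : ℕ → ℕ} {m : ℕ} (h : IsPath i m) (hi : i m ≠ 0) :
    IsPath (stepDown i m) (m + 1) := by
  refine ⟨by rw [stepDown_of_le i (Nat.zero_le _), h.1], fun k hk => ?_⟩
  rcases Nat.lt_succ_iff_lt_or_eq.1 hk with hk | rfl
  · rw [stepDown_of_le i hk, stepDown_of_le i hk.le]; exact h.2 k hk
  · rw [stepDown_succ, stepDown_of_le i le_rfl]; omega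

lemma IsPath.le {i : ℕ → ℕ} {m : ℕ} (h : IsPath i m) : ∀ k ≤ m, i k ≤ k := by
  intro k
  induction k with
  | zero => intro _; rw [h.1]
  | succ k ih => intro hk; have := ih (by omega); have := h.2 k (by omega); omega

lemma downSteps_zero (i : ℕ → ℕ) (m : ℕ) : downSteps i m 0 = 0 := by
  simp [downSteps]

lemma traversals_succ (i : ℕ → ℕ) (m x : ℕ) :
    traversals i (m + 1) x = traversals i m x
      + if s(i m, i (m + 1)) = s(x, x + 1) then 1 else 0 := by
  simp only [traversals, Finset.card_filter, Finset.sum_range_succ]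

lemma traversals_eq (i : ℕ → ℕ) (m x : ℕ) :
    traversals i m x = upSteps i m x + downSteps i m (x + 1) := by
  induction m with
  | zero => simp [traversals, upSteps, downSteps]
  | succ m ih =>
    rw [traversals_succ, ih, upSteps, downSteps, upSteps, downSteps, Finset.sum_range_succ,
      Finset.sum_range_succ]
    have : (if s(i m, i (m + 1)) = s(x, x + 1) then 1 else 0)
        = (if i m = x ∧ i (m + 1) = x + 1 then 1 else 0)
          + if i m = x + 1 ∧ i (m + 1) + 1 = x + 1 then 1 else 0 := by
      simp only [Sym2.eq_iff]
      split_ifs <;> omega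
    omega

/-- Crossings of an edge alternate in direction, and the first is to the right because the path
starts at `0`. -/
lemma IsPath.upSteps_eq {i : ℕ → ℕ} {m : ℕ} (h : IsPath i m) (x : ℕ) :
    upSteps i m x = downSteps i m (x + 1) + if x < i m then 1 else 0 := by
  induction m with
  | zero => simp [upSteps, downSteps, h.1]
  | succ m ih =>
    have ih := ih ⟨h.1, fun k hk => h.2 k (by omega)⟩
    have := h.2 m (by omega)
    simp only [upSteps, downSteps, Finset.sum_range_succ] at ih ⊢
    rw [ih]
    split_ifs <;> omega

/-- This parity, with the odd count for the left edge, is the source of the urn: each departure from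
a site is followed by a return through the same edge, which adds `2 * Δ` to its weight. -/
lemma IsPath.traversals_right {i : ℕ → ℕ} {m : ℕ} (h : IsPath i m) :
    traversals i m (i m) = 2 * upSteps i m (i m) := by
  have := h.upSteps_eq (i m)
  rw [traversals_eq]
  simp at this
  omega

lemma IsPath.traversals_left {i : ℕ → ℕ} {m x : ℕ} (h : IsPath i m) (hx : i m = x + 1) :
    traversals i m x = 2 * downSteps i m (i m) + 1 := by
  have := h.upSteps_eq x
  rw [traversals_eq, hx]
  rw [if_pos (by omega)] at this
  omega

/-! ### Mixtures of walks in random environment -/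

/-- The monomial `∏ y < M, p y ^ r y * (1 - p y) ^ l y` in the environment. -/
def envMonomial (M : ℕ) (r l : ℕ → ℕ) (p : ℕ → ℝ) : ℝ :=
  ∏ y ∈ Finset.range M, p y ^ r y * (1 - p y) ^ l y

/-- The step law of the random walk in the environment `p`. -/
def quenched (p : ℕ → ℝ) (i : ℕ → ℕ) (m : ℕ) : ℝ := p (i m)

lemma envMonomial_up {M x : ℕ} (hx : x < M) (r l : ℕ → ℕ) (p : ℕ → ℝ) :
    envMonomial M (fun y => r y + if y = x then 1 else 0) l p = p x * envMonomial M r l p := by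
  have h : ∀ y, p y ^ (r y + if y = x then 1 else 0) * (1 - p y) ^ l y
      = (if y = x then p x else 1) * (p y ^ r y * (1 - p y) ^ l y) := by
    intro y
    split_ifs with h
    · subst h; ring
    · ring
  simp only [envMonomial, h, Finset.prod_mul_distrib]
  rw [Finset.prod_ite_eq' , if_pos (Finset.mem_range.2 hx)]

lemma envMonomial_down {M x : ℕ} (hx : x < M) (r l : ℕ → ℕ) (p : ℕ → ℝ) :
    envMonomial M r (fun y => l y + if y = x then 1 else 0) p
      = (1 - p x) * envMonomial M r l p := by
  have h : ∀ y, p y ^ r y * (1 - p y) ^ (l y + if y = x then 1 else 0)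
      = (if y = x then 1 - p x else 1) * (p y ^ r y * (1 - p y) ^ l y) := by
    intro y
    split_ifs with h
    · subst h; ring
    · ring
  simp only [envMonomial, h, Finset.prod_mul_distrib]
  rw [Finset.prod_ite_eq' , if_pos (Finset.mem_range.2 hx)]

lemma measurable_envMonomial (M : ℕ) (r l : ℕ → ℕ) : Measurable (envMonomial M r l) := by
  unfold envMonomial
  fun_prop

lemma measurable_pathMean (φ : (ℕ → ℕ) → ℝ) (n : ℕ) :
    ∀ (m : ℕ) (i : ℕ → ℕ), Measurable fun p => pathMean (quenched p) φ n m i := by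
  induction n with
  | zero => intro m i; exact measurable_const
  | succ n ih =>
    intro m i
    have h1 := ih (m + 1) (stepUp i m)
    have h2 := ih (m + 1) (stepDown i m)
    have h3 : Measurable fun p : ℕ → ℝ => quenched p i m := measurable_pi_apply _
    exact (h3.mul h1).add ((h3.const_sub 1).mul h2)

lemma pathMean_mem_Icc {q : (ℕ → ℕ) → ℕ → ℝ} (hq : ∀ i m, q i m ∈ Set.Icc (0 : ℝ) 1)
    {φ : (ℕ → ℕ) → ℝ} (hφ : ∀ i, φ i ∈ Set.Icc (0 : ℝ) 1) (n : ℕ) :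
    ∀ (m : ℕ) (i : ℕ → ℕ), pathMean q φ n m i ∈ Set.Icc (0 : ℝ) 1 := by
  induction n with
  | zero => exact fun m i => hφ i
  | succ n ih =>
    intro m i
    have h1 := ih (m + 1) (stepUp i m)
    have h2 := ih (m + 1) (stepDown i m)
    have h3 := hq i m
    rw [pathMean]
    constructor
    · exact add_nonneg (mul_nonneg h3.1 h1.1) (mul_nonneg (by linarith [h3.2]) h2.1)
    · nlinarith [h1.2, h2.2, h3.1, h3.2]

lemma envMonomial_mem_Icc {p : ℕ → ℝ} (hp : ∀ y, p y ∈ Set.Icc (0 : ℝ) 1) (M : ℕ)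
    (r l : ℕ → ℕ) : envMonomial M r l p ∈ Set.Icc (0 : ℝ) 1 := by
  have h0 : ∀ y, 0 ≤ 1 - p y := fun y => by linarith [(hp y).2]
  have h1 : ∀ y, 1 - p y ≤ 1 := fun y => by linarith [(hp y).1]
  refine ⟨Finset.prod_nonneg fun y _ => mul_nonneg (pow_nonneg (hp y).1 _) (pow_nonneg (h0 y) _),
    Finset.prod_le_one (fun y _ => mul_nonneg (pow_nonneg (hp y).1 _) (pow_nonneg (h0 y) _))
      fun y _ => mul_le_one₀ (pow_le_one₀ (hp y).1 (hp y).2) (pow_nonneg (h0 y) _)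
        (pow_le_one₀ (h0 y) (h1 y))⟩

/-- If the posterior mean of the environment at the current position is the step probability of
the process `q`, then `q` is the mixture of the walks in random environment. -/
lemma integral_monomial_mul_pathMean {Q : Measure (ℕ → ℝ)} [IsProbabilityMeasure Q]
    (hQ : ∀ᵐ p ∂Q, ∀ y, p y ∈ Set.Icc (0 : ℝ) 1) (hQ0 : ∀ᵐ p ∂Q, p 0 = 1)
    {q : (ℕ → ℕ) → ℕ → ℝ} (hq0 : ∀ i m, i m = 0 → q i m = 1)
    (hq : ∀ (M m : ℕ) (i : ℕ → ℕ), m < M → IsPath i m →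
      ∫ p, p (i m) * envMonomial M (upSteps i m) (downSteps i m) p ∂Q
        = q i m * ∫ p, envMonomial M (upSteps i m) (downSteps i m) p ∂Q)
    {φ : (ℕ → ℕ) → ℝ} (hφ : ∀ i, φ i ∈ Set.Icc (0 : ℝ) 1) {M : ℕ} (n : ℕ) :
    ∀ (m : ℕ) (i : ℕ → ℕ), IsPath i m → m + n < M →
      ∫ p, envMonomial M (upSteps i m) (downSteps i m) p * pathMean (quenched p) φ n m i ∂Q
        = (∫ p, envMonomial M (upSteps i m) (downSteps i m) p ∂Q) * pathMean q φ n m i := by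
  have hint : ∀ r l : ℕ → ℕ, Integrable (envMonomial M r l) Q := fun r l => by
    refine Integrable.of_bound (measurable_envMonomial M r l).aestronglyMeasurable 1 ?_
    filter_upwards [hQ] with p hp
    have := envMonomial_mem_Icc hp M r l
    rw [Real.norm_of_nonneg this.1]; exact this.2
  have hint2 : ∀ (r l : ℕ → ℕ) (n m : ℕ) (i : ℕ → ℕ), Integrable
      (fun p => envMonomial M r l p * pathMean (quenched p) φ n m i) Q := fun r l n m i => by
    refine Integrable.of_bound ((measurable_envMonomial M r l).mul
      (measurable_pathMean φ n m i)).aestronglyMeasurable 1 ?_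
    filter_upwards [hQ] with p hp
    have h1 := envMonomial_mem_Icc hp M r l
    have h2 := pathMean_mem_Icc (q := quenched p) (fun i m => hp (i m)) hφ n m i
    rw [Real.norm_of_nonneg (mul_nonneg h1.1 h2.1)]
    exact mul_le_one₀ h1.2 h2.1 h2.2
  induction n with
  | zero =>
    intro m i _ _
    simp only [pathMean]
    rw [integral_mul_const]
  | succ n ih =>
    intro m i hi hm
    have hx : i m < M := by have := hi.le m le_rfl; omega
    have hup : upSteps (stepUp i m) (m + 1)
        = fun y => upSteps i m y + if y = i m then 1 else 0 := funext (upSteps_stepUp i m)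
    have hup' : downSteps (stepUp i m) (m + 1) = downSteps i m := funext (downSteps_stepUp i m)
    have e1 := ih (m + 1) (stepUp i m) hi.stepUp (by omega)
    have i1 := hint2 (upSteps (stepUp i m) (m + 1)) (downSteps (stepUp i m) (m + 1)) n (m + 1)
      (stepUp i m)
    rw [hup, hup'] at e1 i1
    -- The monomial is the quenched likelihood of the path so far; a step to the right multiplies it
    -- by `p (i m)`, and `hq` evaluates the resulting integral.
    simp only [envMonomial_up hx] at e1 i1
    rw [hq M m i (by omega) hi] at e1
    by_cases h0 : i m = 0
    · have : ∫ p, envMonomial M (upSteps i m) (downSteps i m) p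
          * pathMean (quenched p) φ (n + 1) m i ∂Q
          = ∫ p, p (i m) * envMonomial M (upSteps i m) (downSteps i m) p
          * pathMean (quenched p) φ n (m + 1) (stepUp i m) ∂Q := by
        refine integral_congr_ae ?_
        filter_upwards [hQ0] with p hp
        simp only [pathMean, quenched, h0, hp]
        ring
      rw [this, e1, pathMean, hq0 i m h0]
      ring
    · have hdn : upSteps (stepDown i m) (m + 1) = upSteps i m := funext (upSteps_stepDown i m)
      have hdn' : downSteps (stepDown i m) (m + 1)
          = fun y => downSteps i m y + if y = i m then 1 else 0 :=
        funext (downSteps_stepDown i h0)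
      have e2 := ih (m + 1) (stepDown i m) (hi.stepDown h0) (by omega)
      have i2 := hint2 (upSteps (stepDown i m) (m + 1)) (downSteps (stepDown i m) (m + 1)) n
        (m + 1) (stepDown i m)
      rw [hdn, hdn'] at e2 i2
      simp only [envMonomial_down hx] at e2 i2
      have h3 : ∫ p, (1 - p (i m)) * envMonomial M (upSteps i m) (downSteps i m) p ∂Q
          = (1 - q i m) * ∫ p, envMonomial M (upSteps i m) (downSteps i m) p ∂Q := by
        have hi3 : Integrable (fun p : ℕ → ℝ =>
            p (i m) * envMonomial M (upSteps i m) (downSteps i m) p) Q := by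
          exact (hint (fun y => upSteps i m y + if y = i m then 1 else 0) (downSteps i m)).congr
            (ae_of_all _ fun p => envMonomial_up hx _ _ p)
        simp only [sub_mul, one_mul]
        rw [integral_sub (hint _ _) hi3, hq M m i (by omega) hi]
      rw [h3] at e2
      have : ∀ p : ℕ → ℝ, envMonomial M (upSteps i m) (downSteps i m) p
          * pathMean (quenched p) φ (n + 1) m i
          = p (i m) * envMonomial M (upSteps i m) (downSteps i m) p
              * pathMean (quenched p) φ n (m + 1) (stepUp i m)
            + (1 - p (i m)) * envMonomial M (upSteps i m) (downSteps i m) p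
              * pathMean (quenched p) φ n (m + 1) (stepDown i m) := fun p => by
        simp only [pathMean, quenched]; ring
      simp only [this]
      rw [integral_add i1 i2, e1, e2, pathMean]
      ring

lemma pathMean_eq_integral {Q : Measure (ℕ → ℝ)} [IsProbabilityMeasure Q]
    (hQ : ∀ᵐ p ∂Q, ∀ y, p y ∈ Set.Icc (0 : ℝ) 1) (hQ0 : ∀ᵐ p ∂Q, p 0 = 1)
    {q : (ℕ → ℕ) → ℕ → ℝ} (hq0 : ∀ i m, i m = 0 → q i m = 1)
    (hq : ∀ (M m : ℕ) (i : ℕ → ℕ), m < M → IsPath i m →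
      ∫ p, p (i m) * envMonomial M (upSteps i m) (downSteps i m) p ∂Q
        = q i m * ∫ p, envMonomial M (upSteps i m) (downSteps i m) p ∂Q)
    {φ : (ℕ → ℕ) → ℝ} (hφ : ∀ i, φ i ∈ Set.Icc (0 : ℝ) 1) (n : ℕ) :
    pathMean q φ n 0 0 = ∫ p, pathMean (quenched p) φ n 0 0 ∂Q := by
  -- The empty path has likelihood `1`, and `n + 1` sites suffice because `n` steps from `0` reach
  -- at most `n`.
  have h := integral_monomial_mul_pathMean hQ hQ0 hq0 hq hφ (M := n + 1) n 0 0
    ⟨rfl, fun k hk => absurd hk (by omega)⟩ (by omega)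
  simpa [envMonomial, upSteps, downSteps] using h.symm

/-! ### Hitting times in a fixed environment -/

section Quenched

/-- The mean time from `y` to `y + 1` of the random walk in the environment `p`. -/
noncomputable def crossTime (p : ℕ → ℝ) : ℕ → ℝ
  | 0 => 1
  | y + 1 => 1 / p (y + 1) + (1 - p (y + 1)) / p (y + 1) * crossTime p y

/-- The mean time from `0` to `x` of the random walk in the environment `p`. -/
noncomputable def hitTime (p : ℕ → ℝ) (x : ℕ) : ℝ := ∑ y ∈ Finset.range x, crossTime p y

/-- An environment: a family of positive step probabilities, with reflection at `0`. -/
structure IsEnv (p : ℕ → ℝ) : Prop where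
  zero : p 0 = 1
  pos : ∀ y, 0 < p y
  le_one : ∀ y, p y ≤ 1

variable {p : ℕ → ℝ}

lemma IsEnv.crossTime_nonneg (hp : IsEnv p) (y : ℕ) : 0 ≤ crossTime p y := by
  induction y with
  | zero => exact zero_le_one
  | succ y ih =>
    have h1 := hp.pos (y + 1)
    have h2 : 0 ≤ 1 - p (y + 1) := by linarith [hp.le_one (y + 1)]
    rw [crossTime]
    positivity

lemma IsEnv.hitTime_nonneg (hp : IsEnv p) (x : ℕ) : 0 ≤ hitTime p x :=
  Finset.sum_nonneg fun y _ => hp.crossTime_nonneg y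

lemma hitTime_succ (p : ℕ → ℝ) (x : ℕ) : hitTime p (x + 1) = hitTime p x + crossTime p x :=
  Finset.sum_range_succ _ _

lemma IsEnv.hitTime_pos (hp : IsEnv p) {x : ℕ} (hx : x ≠ 0) : 0 < hitTime p x := by
  obtain ⟨x, rfl⟩ := Nat.exists_eq_succ_of_ne_zero hx
  rw [hitTime, Finset.sum_range_succ']
  have := Finset.sum_nonneg (s := Finset.range x) fun y _ => hp.crossTime_nonneg (y + 1)
  simp only [crossTime] at this ⊢
  linarith

/-- This is the martingale property of `hitTime` of the position minus elapsed time. At `y = 0` the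
meaningless left neighbour has coefficient zero. -/
lemma IsEnv.hitTime_step (hp : IsEnv p) (y : ℕ) :
    p y * hitTime p (y + 1) + (1 - p y) * hitTime p (y - 1) = hitTime p y + 1 := by
  cases y with
  | zero => simp [hp.zero, hitTime, crossTime]
  | succ y =>
    have h := (hp.pos (y + 1)).ne'
    rw [Nat.add_sub_cancel, hitTime_succ p (y + 1), hitTime_succ p y, crossTime]
    field_simp
    ring

lemma IsEnv.quenched_mem_Icc (hp : IsEnv p) (i : ℕ → ℕ) (m : ℕ) :
    quenched p i m ∈ Set.Icc (0 : ℝ) 1 := ⟨(hp.pos _).le, hp.le_one _⟩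

lemma indicator_one_mem_Icc (A : Set (ℕ → ℕ)) (i : ℕ → ℕ) :
    A.indicator (1 : (ℕ → ℕ) → ℝ) i ∈ Set.Icc (0 : ℝ) 1 := by
  by_cases h : i ∈ A <;> simp [h]

/-- The paths that reach the level `x` by time `n`. -/
def reachedBy (x n : ℕ) : Set (ℕ → ℕ) := {i | ∃ j ≤ n, x ≤ i j}

lemma dependsUpTo_reachedBy {x n N : ℕ} (h : n ≤ N) : DependsUpTo (reachedBy x n) N := by
  rintro i j hij ⟨k, hk, hx⟩
  exact ⟨k, hk, by rwa [← hij k (hk.trans h)]⟩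

lemma DependsUpTo.compl {A : Set (ℕ → ℕ)} {N : ℕ} (h : DependsUpTo A N) : DependsUpTo Aᶜ N :=
  fun i j hij hi hj => hi (h j i (fun k hk => (hij k hk).symm) hj)

/-- If the value of an indicator is already decided by time `m`, then so is its mean. -/
lemma pathMean_indicator_eq_zero (q : (ℕ → ℕ) → ℕ → ℝ) {A : Set (ℕ → ℕ)} (n : ℕ) :
    ∀ (m : ℕ) (i : ℕ → ℕ), (∀ j : ℕ → ℕ, (∀ k ≤ m, j k = i k) → j ∉ A) →
      pathMean q (A.indicator 1) n m i = 0 := by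
  induction n with
  | zero => intro m i h; simp [pathMean, h i fun _ _ => rfl]
  | succ n ih =>
    intro m i h
    rw [pathMean, ih, ih, mul_zero, mul_zero, add_zero]
    · exact fun j hj => h j fun k hk => by rw [hj k (by omega), stepDown_of_le i hk]
    · exact fun j hj => h j fun k hk => by rw [hj k (by omega), stepUp_of_le i hk]

/-- Optional stopping: `hitTime` of the position plus the remaining time `n₀ - m` is a nonnegative
martingale, and it is at least `hitTime p x` when `x` is reached. -/
lemma IsEnv.pathMean_reachedBy_le (hp : IsEnv p) {x n₀ N : ℕ} (hN : n₀ ≤ N) (n : ℕ) :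
    ∀ (m : ℕ) (i : ℕ → ℕ), m + n = N → m ≤ n₀ → (∀ k ≤ m, i k < x) →
      hitTime p x * pathMean (quenched p) ((reachedBy x n₀).indicator 1) n m i
        ≤ hitTime p (i m) + (n₀ - m : ℕ) := by
  induction n with
  | zero =>
    intro m i hm hmn hi
    have : i ∉ reachedBy x n₀ := by
      rintro ⟨j, hj, hx⟩
      exact absurd (hi j (by omega)) (by omega)
    rw [pathMean, Set.indicator_of_notMem this, mul_zero]
    have := hp.hitTime_nonneg (i m)
    positivity
  | succ n ih =>
    intro m i hm hmn hi
    have hg := hp.hitTime_nonneg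
    rcases hmn.lt_or_eq with hlt | rfl
    · have hcast : ((n₀ - m : ℕ) : ℝ) = ((n₀ - (m + 1) : ℕ) : ℝ) + 1 := by
        rw [← Nat.cast_succ]; congr 1; omega
      have hup : hitTime p x * pathMean (quenched p) ((reachedBy x n₀).indicator 1) n (m + 1)
          (stepUp i m) ≤ hitTime p (i m + 1) + (n₀ - (m + 1) : ℕ) := by
        by_cases hx : i m + 1 < x
        · have := ih (m + 1) (stepUp i m) (by omega) hlt fun k hk => by
            rcases Nat.le_succ_iff.1 hk with hk | rfl
            · rw [stepUp_of_le i hk]; exact hi k hk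
            · rw [stepUp_succ]; exact hx
          rwa [stepUp_succ] at this
        -- The step up hits `x`, where bounding the probability by one is enough.
        · have : i m + 1 = x := by have := hi m le_rfl; omega
          rw [this]
          have h1 := (pathMean_mem_Icc (q := quenched p) hp.quenched_mem_Icc
            (indicator_one_mem_Icc (reachedBy x n₀)) n (m + 1) (stepUp i m)).2
          have h2 : (0 : ℝ) ≤ (n₀ - (m + 1) : ℕ) := Nat.cast_nonneg _
          nlinarith [hg x]
      have hdown : hitTime p x * pathMean (quenched p) ((reachedBy x n₀).indicator 1) n (m + 1)
          (stepDown i m) ≤ hitTime p (i m - 1) + (n₀ - (m + 1) : ℕ) := by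
        have := ih (m + 1) (stepDown i m) (by omega) hlt fun k hk => by
          rcases Nat.le_succ_iff.1 hk with hk | rfl
          · rw [stepDown_of_le i hk]; exact hi k hk
          · rw [stepDown_succ]; have := hi m le_rfl; omega
        rwa [stepDown_succ] at this
      have h1 := mul_le_mul_of_nonneg_left hup (hp.pos (i m)).le
      have h2 := mul_le_mul_of_nonneg_left hdown (sub_nonneg.2 (hp.le_one (i m)))
      have h3 := hp.hitTime_step (i m)
      rw [pathMean, quenched, hcast]
      linarith
    · rw [pathMean_indicator_eq_zero, mul_zero]
      · have := hg (i m)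
        positivity
      · rintro j hj ⟨k, hk, hx⟩
        have := hi k hk
        rw [hj k hk] at hx
        omega

lemma IsEnv.pathMean_reachedBy (hp : IsEnv p) {x n N : ℕ} (hx : x ≠ 0) (hN : n ≤ N) :
    pathMean (quenched p) ((reachedBy x n).indicator 1) N 0 0 ≤ n / hitTime p x := by
  rw [le_div_iff₀' (hp.hitTime_pos hx)]
  have := hp.pathMean_reachedBy_le (x := x) hN N 0 0 (by omega) (by omega)
    fun k _ => Nat.pos_of_ne_zero hx
  simpa [hitTime] using this

/-- The right side is the mean remaining time to `x`, so this is Markov's inequality in inductive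
form. Passing from `n` to `n + 1` costs one more copy of a probability, paid for by the unit of time
in `hitTime_step`. -/
lemma IsEnv.pathMean_not_reachedBy_le (hp : IsEnv p) {x N : ℕ} (n : ℕ) :
    ∀ (m : ℕ) (i : ℕ → ℕ), m + n = N → i m ≤ x →
      n * pathMean (quenched p) ((reachedBy x N)ᶜ.indicator 1) n m i
        ≤ hitTime p x - hitTime p (i m) := by
  induction n with
  | zero =>
    intro m i _ hi
    have h : hitTime p (i m) ≤ hitTime p x :=
      Finset.sum_le_sum_of_subset_of_nonneg (Finset.range_mono hi)
        fun y _ _ => hp.crossTime_nonneg y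
    simpa using h
  | succ n ih =>
    intro m i hm hi
    rcases hi.lt_or_eq with hi | hi
    · have hup := ih (m + 1) (stepUp i m) (by omega) (by rw [stepUp_succ]; omega)
      have hdown := ih (m + 1) (stepDown i m) (by omega) (by rw [stepDown_succ]; omega)
      rw [stepUp_succ] at hup
      rw [stepDown_succ] at hdown
      have h0 := (pathMean_mem_Icc (q := quenched p) hp.quenched_mem_Icc
        (indicator_one_mem_Icc (reachedBy x N)ᶜ) (n + 1) m i).2
      have h1 := mul_le_mul_of_nonneg_left hup (hp.pos (i m)).le
      have h2 := mul_le_mul_of_nonneg_left hdown (sub_nonneg.2 (hp.le_one (i m)))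
      have h3 := hp.hitTime_step (i m)
      have h4 : pathMean (quenched p) ((reachedBy x N)ᶜ.indicator 1) (n + 1) m i = p (i m)
          * pathMean (quenched p) ((reachedBy x N)ᶜ.indicator 1) n (m + 1) (stepUp i m)
          + (1 - p (i m))
          * pathMean (quenched p) ((reachedBy x N)ᶜ.indicator 1) n (m + 1) (stepDown i m) := rfl
      have h5 := congrArg (fun t => (n : ℝ) * t) h4
      push_cast
      rw [add_mul, one_mul]
      linarith
    · rw [pathMean_indicator_eq_zero, mul_zero, hi, sub_self]
      intro j hj h
      exact h ⟨m, by omega, by rw [hj m le_rfl, hi]⟩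

lemma IsEnv.pathMean_not_reachedBy (hp : IsEnv p) {x N : ℕ} (hN : N ≠ 0) :
    pathMean (quenched p) ((reachedBy x N)ᶜ.indicator 1) N 0 0 ≤ hitTime p x / N := by
  rw [le_div_iff₀' (by positivity)]
  have := hp.pathMean_not_reachedBy_le (x := x) (N := N) N 0 0 (by omega) (Nat.zero_le _)
  simpa [hitTime] using this

lemma pathMean_mono {q : (ℕ → ℕ) → ℕ → ℝ} (hq : ∀ i m, q i m ∈ Set.Icc (0 : ℝ) 1)
    {φ ψ : (ℕ → ℕ) → ℝ} (h : ∀ i, φ i ≤ ψ i) (n : ℕ) :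
    ∀ (m : ℕ) (i : ℕ → ℕ), pathMean q φ n m i ≤ pathMean q ψ n m i := by
  induction n with
  | zero => exact fun m i => h i
  | succ n ih =>
    intro m i
    exact add_le_add (mul_le_mul_of_nonneg_left (ih _ _) (hq i m).1)
      (mul_le_mul_of_nonneg_left (ih _ _) (sub_nonneg.2 (hq i m).2))

lemma pathMean_sum (q : (ℕ → ℕ) → ℕ → ℝ) {ι : Type*} (s : Finset ι)
    (φ : ι → (ℕ → ℕ) → ℝ) (n : ℕ) :
    ∀ (m : ℕ) (i : ℕ → ℕ), pathMean q (fun j => ∑ a ∈ s, φ a j) n m i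
      = ∑ a ∈ s, pathMean q (φ a) n m i := by
  induction n with
  | zero => exact fun m i => rfl
  | succ n ih =>
    intro m i
    simp only [pathMean, ih, Finset.sum_add_distrib, Finset.mul_sum]

/-- Union bound for the walk in a fixed environment. -/
lemma IsEnv.pathMean_iUnion_reachedBy (hp : IsEnv p) {ι : Type*} (s : Finset ι) (x n : ι → ℕ)
    {N : ℕ} (hx : ∀ a ∈ s, x a ≠ 0) (hN : ∀ a ∈ s, n a ≤ N) :
    pathMean (quenched p) ((⋃ a ∈ s, reachedBy (x a) (n a)).indicator 1) N 0 0
      ≤ ∑ a ∈ s, n a / hitTime p (x a) := by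
  refine (pathMean_mono hp.quenched_mem_Icc
    (ψ := fun i => ∑ a ∈ s, (reachedBy (x a) (n a)).indicator 1 i) (fun i => ?_) N 0 0).trans ?_
  · have hnn : ∀ a ∈ s, (0 : ℝ) ≤ (reachedBy (x a) (n a)).indicator 1 i :=
      fun a _ => (indicator_one_mem_Icc _ i).1
    by_cases h : i ∈ ⋃ a ∈ s, reachedBy (x a) (n a)
    · obtain ⟨a, ha, hi⟩ := Set.mem_iUnion₂.1 h
      rw [Set.indicator_of_mem h]
      refine le_trans ?_ (Finset.single_le_sum hnn ha)
      rw [Set.indicator_of_mem hi]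
    · rw [Set.indicator_of_notMem h]
      exact Finset.sum_nonneg hnn
  · rw [pathMean_sum]
    exact Finset.sum_le_sum fun a ha => hp.pathMean_reachedBy (hx a ha) (hN a ha)

end Quenched

/-! ### Pólya urns and the Beta environment -/

section Mixture

section Beta

variable {a b : ℝ}

lemma beta_add_one_left (ha : 0 < a) (hb : 0 < b) : beta (a + 1) b = a / (a + b) * beta a b := by
  have h1 := (Real.Gamma_pos_of_pos (add_pos ha hb)).ne'
  have h2 := (add_pos ha hb).ne'
  rw [beta, beta, Real.Gamma_add_one ha.ne', add_right_comm, Real.Gamma_add_one h2]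
  field_simp

lemma betaMeasure_ae_mem_Ioo (a b : ℝ) : ∀ᵐ x ∂betaMeasure a b, x ∈ Set.Ioo (0 : ℝ) 1 := by
  have hm : Measurable (betaPDF a b) := (measurable_betaPDFReal a b).ennreal_ofReal
  rw [betaMeasure, ae_withDensity_iff hm]
  refine ae_of_all _ fun x hx => ?_
  by_contra h
  apply hx
  rw [betaPDF_eq, if_neg (show ¬(0 < x ∧ x < 1) from h), ENNReal.ofReal_zero]

lemma betaPDFReal_nonneg (ha : 0 < a) (hb : 0 < b) (x : ℝ) : 0 ≤ betaPDFReal a b x := by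
  by_cases h : 0 < x ∧ x < 1
  · exact (betaPDFReal_pos h.1 h.2 ha hb).le
  · rw [betaPDFReal, if_neg h]

lemma integral_betaMeasure (ha : 0 < a) (hb : 0 < b) (g : ℝ → ℝ) :
    ∫ x, g x ∂betaMeasure a b = ∫ x, betaPDFReal a b x * g x := by
  have hm : Measurable (betaPDF a b) := (measurable_betaPDFReal a b).ennreal_ofReal
  rw [betaMeasure, integral_withDensity_eq_integral_toReal_smul hm
    (ae_of_all _ fun x => ENNReal.ofReal_lt_top)]
  simp only [betaPDF, ENNReal.toReal_ofReal (betaPDFReal_nonneg ha hb _), smul_eq_mul]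

lemma integral_betaPDFReal (ha : 0 < a) (hb : 0 < b) : ∫ x, betaPDFReal a b x = 1 := by
  have := isProbabilityMeasureBeta ha hb
  have h := integral_betaMeasure ha hb fun _ => 1
  simpa using h.symm

/-- Conjugacy: a monomial times a Beta density is an unnormalised Beta density with shifted
parameters. -/
lemma integral_betaMeasure_monomial (ha : 0 < a) (hb : 0 < b) (r l : ℕ) :
    ∫ x, x ^ r * (1 - x) ^ l ∂betaMeasure a b = beta (a + r) (b + l) / beta a b := by
  have ha' : 0 < a + r := by positivity
  have hb' : 0 < b + l := by positivity
  have key : ∀ x, betaPDFReal a b x * (x ^ r * (1 - x) ^ l)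
      = beta (a + r) (b + l) / beta a b * betaPDFReal (a + r) (b + l) x := by
    intro x
    simp only [betaPDFReal]
    split_ifs with h
    · have h1 : x ^ (a + r - 1) = x ^ (a - 1) * x ^ r := by
        rw [← Real.rpow_natCast, ← Real.rpow_add h.1]; ring_nf
      have h2 : (1 - x) ^ (b + l - 1) = (1 - x) ^ (b - 1) * (1 - x) ^ l := by
        rw [← Real.rpow_natCast, ← Real.rpow_add (by linarith [h.2])]; ring_nf
      have h3 := (beta_pos ha hb).ne'
      have h4 := (beta_pos ha' hb').ne'
      rw [h1, h2]
      field_simp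
    · simp
  rw [integral_betaMeasure ha hb]
  simp only [key]
  rw [integral_const_mul, integral_betaPDFReal ha' hb', mul_one]

/-- The fraction is the posterior mean after `r` draws to the right and `l` to the left. -/
lemma integral_betaMeasure_mul_monomial (ha : 0 < a) (hb : 0 < b) (r l : ℕ) :
    ∫ x, x * (x ^ r * (1 - x) ^ l) ∂betaMeasure a b
      = (a + r) / (a + r + (b + l)) * ∫ x, x ^ r * (1 - x) ^ l ∂betaMeasure a b := by
  have h := integral_betaMeasure_monomial ha hb (r + 1) l
  have hi : ∀ x : ℝ, x * (x ^ r * (1 - x) ^ l) = x ^ (r + 1) * (1 - x) ^ l := fun x => by ring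
  simp only [hi]
  rw [h, integral_betaMeasure_monomial ha hb, Nat.cast_succ, ← add_assoc,
    beta_add_one_left (by positivity) (by positivity), mul_div_assoc]

end Beta

/-- The parameter of the step to the right in the urn at `y`. -/
noncomputable def rightParam (w : ℕ → ℝ) (Δ : ℝ) (y : ℕ) : ℝ := w y / (2 * Δ)

/-- The parameter of the step to the left in the urn at `y ≠ 0`. -/
noncomputable def leftParam (w : ℕ → ℝ) (Δ : ℝ) (y : ℕ) : ℝ := (w (y - 1) + Δ) / (2 * Δ)

/-- The law of the step probability at `y` in the random environment. -/
noncomputable def siteMeasure (w : ℕ → ℝ) (Δ : ℝ) (y : ℕ) : Measure ℝ :=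
  if y = 0 then Measure.dirac 1 else betaMeasure (rightParam w Δ y) (leftParam w Δ y)

/-- The law of the random environment. -/
noncomputable def envMeasure (w : ℕ → ℝ) (Δ : ℝ) : Measure (ℕ → ℝ) :=
  Measure.infinitePi (siteMeasure w Δ)

variable {w : ℕ → ℝ} {Δ : ℝ}

lemma rightParam_pos (hw : ∀ y, 0 < w y) (hΔ : 0 < Δ) (y : ℕ) : 0 < rightParam w Δ y := by
  have := hw y
  unfold rightParam; positivity

lemma leftParam_pos (hw : ∀ y, 0 < w y) (hΔ : 0 < Δ) (y : ℕ) : 0 < leftParam w Δ y := by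
  have := hw (y - 1)
  unfold leftParam; positivity

lemma isProbabilityMeasure_siteMeasure (hw : ∀ y, 0 < w y) (hΔ : 0 < Δ) (y : ℕ) :
    IsProbabilityMeasure (siteMeasure w Δ y) := by
  unfold siteMeasure
  split_ifs
  · infer_instance
  · exact isProbabilityMeasureBeta (rightParam_pos hw hΔ y) (leftParam_pos hw hΔ y)

lemma isProbabilityMeasure_envMeasure (hw : ∀ y, 0 < w y) (hΔ : 0 < Δ) :
    IsProbabilityMeasure (envMeasure w Δ) := by
  have := isProbabilityMeasure_siteMeasure hw hΔ
  unfold envMeasure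
  infer_instance

lemma envMeasure_map_eval (hw : ∀ y, 0 < w y) (hΔ : 0 < Δ) (y : ℕ) :
    (envMeasure w Δ).map (fun p => p y) = siteMeasure w Δ y := by
  have := isProbabilityMeasure_siteMeasure hw hΔ
  exact Measure.infinitePi_map_eval (siteMeasure w Δ) y

lemma integral_envMeasure_eval (hw : ∀ y, 0 < w y) (hΔ : 0 < Δ) (y : ℕ) {g : ℝ → ℝ}
    (hg : Measurable g) : ∫ p, g (p y) ∂envMeasure w Δ = ∫ x, g x ∂siteMeasure w Δ y := by
  rw [← envMeasure_map_eval hw hΔ y, integral_map (measurable_pi_apply y).aemeasurable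
    hg.aestronglyMeasurable]

lemma iIndepFun_envMeasure (hw : ∀ y, 0 < w y) (hΔ : 0 < Δ) :
    iIndepFun (fun y (p : ℕ → ℝ) => p y) (envMeasure w Δ) := by
  have := isProbabilityMeasure_siteMeasure hw hΔ
  exact iIndepFun_infinitePi (P := siteMeasure w Δ) (X := fun _ x => x) fun _ => measurable_id

lemma envMeasure_ae_isEnv (hw : ∀ y, 0 < w y) (hΔ : 0 < Δ) :
    ∀ᵐ p ∂envMeasure w Δ, IsEnv p ∧ ∀ y ≠ 0, p y < 1 := by
  have h : ∀ᵐ p ∂envMeasure w Δ, ∀ y, (y = 0 → p y = 1) ∧ (y ≠ 0 → p y ∈ Set.Ioo (0 : ℝ) 1) := by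
    refine ae_all_iff.2 fun y => ?_
    have hs : ∀ᵐ x ∂siteMeasure w Δ y, (y = 0 → x = 1) ∧ (y ≠ 0 → x ∈ Set.Ioo (0 : ℝ) 1) := by
      by_cases hy : y = 0
      · rw [siteMeasure, if_pos hy]
        simp [hy, ae_dirac_eq]
      · rw [siteMeasure, if_neg hy]
        filter_upwards [betaMeasure_ae_mem_Ioo (rightParam w Δ y) (leftParam w Δ y)] with x hx
        exact ⟨fun h => absurd h hy, fun _ => hx⟩
    rw [← envMeasure_map_eval hw hΔ y] at hs
    exact ae_of_ae_map (measurable_pi_apply y).aemeasurable hs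
  filter_upwards [h] with p hp
  refine ⟨⟨(hp 0).1 rfl, fun y => ?_, fun y => ?_⟩, fun y hy => ((hp y).2 hy).2⟩
  all_goals
    by_cases hy : y = 0
    · subst hy; simp [(hp 0).1 rfl]
  · exact ((hp y).2 hy).1
  · exact ((hp y).2 hy).2.le

lemma integral_envMonomial (hw : ∀ y, 0 < w y) (hΔ : 0 < Δ) (M : ℕ) (r l : ℕ → ℕ) :
    ∫ p, envMonomial M r l p ∂envMeasure w Δ
      = ∏ y ∈ Finset.range M, ∫ x, x ^ r y * (1 - x) ^ l y ∂siteMeasure w Δ y := by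
  have hi : iIndepFun (fun (k : Fin M) (p : ℕ → ℝ) => p k) (envMeasure w Δ) :=
    (iIndepFun_envMeasure hw hΔ).precomp Fin.val_injective
  have h := hi.integral_fun_prod_comp
    (f := fun (k : Fin M) (x : ℝ) => x ^ r k * (1 - x) ^ l k)
    (fun k => (measurable_pi_apply (k : ℕ)).aemeasurable)
    (fun k => by fun_prop)
  simp only [envMonomial, ← Fin.prod_univ_eq_prod_range
    (fun y => ∫ x, x ^ r y * (1 - x) ^ l y ∂siteMeasure w Δ y)]
  simp only [fun p : ℕ → ℝ => (Fin.prod_univ_eq_prod_range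
    (fun y => p y ^ r y * (1 - p y) ^ l y) M).symm]
  rw [h]
  exact Finset.prod_congr rfl fun k _ =>
    integral_envMeasure_eval hw hΔ k (g := fun x => x ^ r k * (1 - x) ^ l k) (by fun_prop)

lemma linearScheme_pos (hw : ∀ y, 0 < w y) (hΔ : 0 < Δ) (l x : ℕ) :
    0 < linearScheme w Δ l x := by
  have := hw x
  unfold linearScheme; positivity

/-- The step probability of the reinforced walk is the posterior mean of the environment. -/
lemma upProb_linearScheme (hΔ : 0 < Δ) {i : ℕ → ℕ} {m : ℕ} (hi : IsPath i m)
    (h0 : i m ≠ 0) :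
    upProb (linearScheme w Δ) i m
      = (rightParam w Δ (i m) + upSteps i m (i m))
        / (rightParam w Δ (i m) + upSteps i m (i m)
          + (leftParam w Δ (i m) + downSteps i m (i m))) := by
  obtain ⟨x, hx⟩ := Nat.exists_eq_succ_of_ne_zero h0
  have hl : leftWeight (linearScheme w Δ) i m (i m)
      = 2 * Δ * (leftParam w Δ (i m) + downSteps i m (i m)) := by
    have h1 : leftWeight (linearScheme w Δ) i m (i m) = weight (linearScheme w Δ) i m x := by
      rw [hx]; rfl
    rw [h1, weight, linearScheme, hi.traversals_left hx, leftParam,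
      show i m - 1 = x by omega]
    push_cast
    field_simp
    ring
  have hr : weight (linearScheme w Δ) i m (i m)
      = 2 * Δ * (rightParam w Δ (i m) + upSteps i m (i m)) := by
    rw [weight, linearScheme, hi.traversals_right, rightParam]
    push_cast
    field_simp
  rw [upProb, hl, hr, ← mul_add, add_comm (leftParam w Δ (i m) + _),
    mul_div_mul_left _ _ (by positivity)]

/-- By independence the integrals factor over sites, and only the factor at the current site
changes. There conjugacy applies; at the origin the Dirac mass at `1` makes the extra factor
trivial. -/
lemma integral_eval_mul_envMonomial (hw : ∀ y, 0 < w y) (hΔ : 0 < Δ) {M m : ℕ} {i : ℕ → ℕ}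
    (hm : m < M) (hi : IsPath i m) :
    ∫ p, p (i m) * envMonomial M (upSteps i m) (downSteps i m) p ∂envMeasure w Δ
      = upProb (linearScheme w Δ) i m
        * ∫ p, envMonomial M (upSteps i m) (downSteps i m) p ∂envMeasure w Δ := by
  have hx : i m ∈ Finset.range M := Finset.mem_range.2 ((hi.le m le_rfl).trans_lt hm)
  have h1 : ∀ p, p (i m) * envMonomial M (upSteps i m) (downSteps i m) p
      = envMonomial M (fun y => upSteps i m y + if y = i m then 1 else 0) (downSteps i m) p :=
    fun p => (envMonomial_up (Finset.mem_range.1 hx) _ _ p).symm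
  simp only [h1]
  rw [integral_envMonomial hw hΔ, integral_envMonomial hw hΔ, ← Finset.mul_prod_erase _ _ hx,
    ← Finset.mul_prod_erase _ (fun y => ∫ x, x ^ upSteps i m y * (1 - x) ^ downSteps i m y
      ∂siteMeasure w Δ y) hx, ← mul_assoc]
  congr 1
  · rw [if_pos rfl]
    by_cases h0 : i m = 0
    · rw [upProb_zero (linearScheme_pos hw hΔ) h0, h0]
      simp [siteMeasure, downSteps_zero]
    · rw [upProb_linearScheme hΔ hi h0, siteMeasure, if_neg h0,
        ← integral_betaMeasure_mul_monomial (rightParam_pos hw hΔ _) (leftParam_pos hw hΔ _)]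
      congr 1
      ext x
      ring
  · refine Finset.prod_congr rfl fun y hy => ?_
    rw [if_neg (Finset.ne_of_mem_erase hy), add_zero]

/-- The linearly reinforced walk is a mixture of random walks in random environment. -/
lemma measureReal_path_eq_integral {Ω : Type*} [MeasurableSpace Ω] {P : Measure Ω}
    [IsProbabilityMeasure P] {X : ℕ → Ω → ℕ} (hw : ∀ y, 0 < w y) (hΔ : 0 < Δ)
    (hX : IsERRW P (linearScheme w Δ) X) {A : Set (ℕ → ℕ)} {N : ℕ} (hA : DependsUpTo A N) :
    P.real {ω | (fun k => X k ω) ∈ A}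
      = ∫ p, pathMean (quenched p) (A.indicator 1) N 0 0 ∂envMeasure w Δ := by
  have := isProbabilityMeasure_envMeasure hw hΔ
  rw [hX.measureReal_path (linearScheme_pos hw hΔ) hA]
  refine pathMean_eq_integral ?_ ?_ (fun i m h => upProb_zero (linearScheme_pos hw hΔ) h)
    (fun M m i hm hi => integral_eval_mul_envMonomial hw hΔ hm hi) (indicator_one_mem_Icc A) N
  · filter_upwards [envMeasure_ae_isEnv hw hΔ] with p hp y
    exact ⟨(hp.1.pos y).le, hp.1.le_one y⟩
  · filter_upwards [envMeasure_ae_isEnv hw hΔ] with p hp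
    exact hp.1.zero

end Mixture

/-! ### Potential, crossing times and growth of the mean hitting time -/

/-- The potential of the environment `p`. -/
noncomputable def potential (p : ℕ → ℝ) (y : ℕ) : ℝ :=
  ∑ u ∈ Finset.range y, Real.log ((1 - p (u + 1)) / p (u + 1))

lemma exp_potential_succ {p : ℕ → ℝ} (hp : IsEnv p) (hp1 : ∀ y ≠ 0, p y < 1) (y : ℕ) :
    Real.exp (potential p (y + 1))
      = (1 - p (y + 1)) / p (y + 1) * Real.exp (potential p y) := by
  have h1 := hp.pos (y + 1)
  have h2 : 0 < 1 - p (y + 1) := sub_pos.2 (hp1 _ (Nat.succ_ne_zero y))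
  rw [potential, Finset.sum_range_succ, Real.exp_add, Real.exp_log (by positivity), mul_comm]
  rfl

/-- The ratio `(1 - p) / p` at `y + 1` is `exp (V (y + 1) - V y)` and `1 / p` is one plus that
ratio. After multiplication by `exp (-V)` the recursion for `crossTime` therefore telescopes. -/
lemma crossTime_eq {p : ℕ → ℝ} (hp : IsEnv p) (hp1 : ∀ y ≠ 0, p y < 1) (y : ℕ) :
    crossTime p y = Real.exp (potential p y) * (1 + ∑ z ∈ Finset.range y,
      (Real.exp (-potential p (z + 1)) + Real.exp (-potential p z))) := by
  induction y with
  | zero => simp [crossTime, potential]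
  | succ y ih =>
    have h := exp_potential_succ hp hp1 y
    have h1 := (hp.pos (y + 1)).ne'
    have h2 : Real.exp (potential p (y + 1)) * Real.exp (-potential p (y + 1)) = 1 := by
      rw [← Real.exp_add, add_neg_cancel, Real.exp_zero]
    have h3 : Real.exp (potential p y) * Real.exp (-potential p y) = 1 := by
      rw [← Real.exp_add, add_neg_cancel, Real.exp_zero]
    have h4 : Real.exp (potential p (y + 1)) * Real.exp (-potential p y)
        = (1 - p (y + 1)) / p (y + 1) := by
      rw [h, mul_assoc, h3, mul_one]
    have h5 : 1 / p (y + 1) = 1 + (1 - p (y + 1)) / p (y + 1) := by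
      field_simp; ring
    rw [crossTime, ih, Finset.sum_range_succ, h5]
    linear_combination (-1 : ℝ) * h2 - h4 - (1 + ∑ z ∈ Finset.range y,
      (Real.exp (-potential p (z + 1)) + Real.exp (-potential p z))) * h

lemma crossTime_ge {p : ℕ → ℝ} (hp : IsEnv p) (hp1 : ∀ y ≠ 0, p y < 1) (y : ℕ) :
    ∑ z ∈ Finset.range (y + 1), Real.exp (potential p y - potential p z) ≤ crossTime p y := by
  rw [crossTime_eq hp hp1]
  simp only [sub_eq_add_neg, Real.exp_add, ← Finset.mul_sum]
  refine mul_le_mul_of_nonneg_left ?_ (Real.exp_pos _).le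
  rw [Finset.sum_range_succ', Finset.sum_add_distrib, add_comm (1 : ℝ)]
  have h := Finset.sum_nonneg (s := Finset.range y) fun z _ => (Real.exp_pos (-potential p z)).le
  have h0 : Real.exp (-potential p 0) = 1 := by simp [potential]
  rw [h0]
  linarith

lemma crossTime_le {p : ℕ → ℝ} (hp : IsEnv p) (hp1 : ∀ y ≠ 0, p y < 1) (y : ℕ) :
    crossTime p y ≤ 2 * ∑ z ∈ Finset.range (y + 1), Real.exp (potential p y - potential p z) := by
  rw [crossTime_eq hp hp1]
  simp only [sub_eq_add_neg, Real.exp_add, ← Finset.mul_sum]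
  rw [mul_left_comm]
  refine mul_le_mul_of_nonneg_left ?_ (Real.exp_pos _).le
  rw [Finset.sum_add_distrib, two_mul]
  have h0 : Real.exp (-potential p 0) = 1 := by simp [potential]
  have h1 := Finset.sum_range_succ' (fun z => Real.exp (-potential p z)) y
  have h2 := Finset.sum_range_succ (fun z => Real.exp (-potential p z)) y
  have h3 := Real.exp_pos (-potential p y)
  rw [h0] at h1
  linarith

/-- The potential of `p` is logarithmic with slope `κ`, up to an error of slope `δ`. -/
def LogPotential (p : ℕ → ℝ) (κ δ C : ℝ) : Prop :=
  ∀ y : ℕ, |potential p y - κ * Real.log (y + 1)| ≤ δ * Real.log (y + 1) + C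

/-- For `z ≤ y`, `exp (V y - V z)` is about `((y + 1) / (z + 1)) ^ κ`, which only grows when `κ` is
replaced by `max κ 1`; the sum over `z` is then almost bounded. -/
lemma hitTime_le {p : ℕ → ℝ} (hp : IsEnv p) (hp1 : ∀ y ≠ 0, p y < 1) {κ δ C : ℝ} (hδ : 0 < δ)
    (h : LogPotential p κ δ C) :
    ∃ K : ℝ, ∀ x : ℕ, hitTime p x ≤ K * (x : ℝ) ^ (max (κ + 1) 2 + 3 * δ) := by
  have hs : Summable fun z : ℕ => ((z + 1 : ℕ) : ℝ) ^ (-1 - δ) :=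
    (summable_nat_add_iff 1).2 (Real.summable_nat_rpow.2 (by linarith))
  set S := ∑' z : ℕ, ((z + 1 : ℕ) : ℝ) ^ (-1 - δ) with hS
  set K := 2 * (Real.exp (2 * C) * S) with hK
  -- The errors contribute `δ` at `y` and `δ` at `z`; forcing the exponent of `z + 1` down to `-1 -
  -- δ`, for summability, costs another `δ`. As `z ≤ y`, all three are charged to `y`.
  set e := max κ 1 + 3 * δ with he
  have he0 : 0 < e := by have := le_max_right κ 1; positivity
  have hS0 : 0 ≤ S := tsum_nonneg fun z => by positivity
  have hterm : ∀ z y : ℕ, z ≤ y → Real.exp (potential p y - potential p z)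
      ≤ Real.exp (2 * C) * (((y + 1 : ℕ) : ℝ) ^ e * ((z + 1 : ℕ) : ℝ) ^ (-1 - δ)) := by
    intro z y hzy
    have hZ : (0 : ℝ) < ((z + 1 : ℕ) : ℝ) := by positivity
    have hY : (0 : ℝ) < ((y + 1 : ℕ) : ℝ) := by positivity
    rw [Real.rpow_def_of_pos hZ, Real.rpow_def_of_pos hY, ← Real.exp_add, ← Real.exp_add]
    refine Real.exp_le_exp.2 ?_
    have h1 := (abs_le.1 (h y)).2
    have h2 := (abs_le.1 (h z)).1
    have h3 : Real.log ((z + 1 : ℕ) : ℝ) ≤ Real.log ((y + 1 : ℕ) : ℝ) :=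
      Real.log_le_log hZ (by exact_mod_cast Nat.succ_le_succ hzy)
    have h4 : 0 ≤ Real.log ((z + 1 : ℕ) : ℝ) := Real.log_natCast_nonneg _
    push_cast at h3 h4 ⊢
    set a := Real.log ((y : ℝ) + 1)
    set b := Real.log ((z : ℝ) + 1)
    have h5 : κ ≤ max κ 1 := le_max_left _ _
    have h6 : 1 ≤ max κ 1 := le_max_right _ _
    have h7 : 0 ≤ (max κ 1 - κ) * (a - b) := mul_nonneg (by linarith) (by linarith)
    have h8 : 0 ≤ (max κ 1 - 1) * b := mul_nonneg (by linarith) h4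
    have h9 : 0 ≤ δ * (a - b) := mul_nonneg hδ.le (by linarith)
    rw [he]
    nlinarith
  have hcross : ∀ y : ℕ, crossTime p y ≤ K * ((y + 1 : ℕ) : ℝ) ^ e := by
    intro y
    have h1 : ∑ z ∈ Finset.range (y + 1), Real.exp (potential p y - potential p z)
        ≤ Real.exp (2 * C) * (((y + 1 : ℕ) : ℝ) ^ e * S) := by
      refine (Finset.sum_le_sum fun z hz => hterm z y
        (Nat.lt_succ_iff.1 (Finset.mem_range.1 hz))).trans ?_
      rw [← Finset.mul_sum, ← Finset.mul_sum]
      gcongr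
      exact hs.sum_le_tsum _ fun z _ => by positivity
    refine (crossTime_le hp hp1 y).trans ?_
    rw [hK]
    linarith
  have hmax : max (κ + 1) 2 + 3 * δ = 1 + e := by
    have : max (κ + 1) 2 = max κ 1 + 1 := by
      rw [← max_add_add_right]; norm_num
    rw [this, he]; ring
  refine ⟨K, fun x => ?_⟩
  rcases Nat.eq_zero_or_pos x with rfl | hx
  · rw [hmax, Nat.cast_zero, Real.zero_rpow (by positivity)]
    simp [hitTime]
  have hxe : (x : ℝ) ^ (1 + e) = x * (x : ℝ) ^ e := by
    rw [Real.rpow_add (by exact_mod_cast hx), Real.rpow_one]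
  rw [hmax, hxe]
  calc hitTime p x ≤ ∑ y ∈ Finset.range x, K * (x : ℝ) ^ e := by
        refine Finset.sum_le_sum fun y hy => (hcross y).trans ?_
        have : ((y + 1 : ℕ) : ℝ) ≤ x := by exact_mod_cast Finset.mem_range.1 hy
        gcongr
    _ = _ := by rw [Finset.sum_const, Finset.card_range, nsmul_eq_mul]; ring

lemma sq_half_le_sum (m : ℕ) : (m : ℝ) ^ 2 / 2 ≤ ∑ j ∈ Finset.range m, ((j : ℝ) + 1) := by
  induction m with
  | zero => simp
  | succ m ih => rw [Finset.sum_range_succ]; push_cast; nlinarith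

lemma hitTime_two_mul_ge {p : ℕ → ℝ} (hp : IsEnv p) (m : ℕ) :
    ∑ j ∈ Finset.range m, crossTime p (m + j) ≤ hitTime p (2 * m) := by
  rw [hitTime, two_mul, Finset.sum_range_add]
  exact le_add_of_nonneg_left (Finset.sum_nonneg fun y _ => hp.crossTime_nonneg y)

/-- Crossings above `m` suffice. If `κ ≥ 1`, the term `z = 0` alone gives each the order `m ^ κ`. If
`κ ≤ 1`, the potential is nearly constant between `m` and `2 * m`, so the crossing at `m + j` costs
about `j + 1`, and these add up to order `m ^ 2`. -/
lemma hitTime_ge {p : ℕ → ℝ} (hp : IsEnv p) (hp1 : ∀ y ≠ 0, p y < 1) {κ δ C : ℝ} (hδ : 0 < δ)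
    (hδ1 : δ ≤ 1) (hκ : -1 ≤ κ) (h : LogPotential p κ δ C) :
    ∃ c > 0, ∀ m : ℕ, m ≠ 0 → c * (m : ℝ) ^ (max (κ + 1) 2 - 2 * δ) ≤ hitTime p (2 * m) := by
  have hC : 0 ≤ C := by simpa [potential] using h 0
  -- The factor `1 / 16` is `2 ^ (-3)`, from `κ ≥ -1` and `δ ≤ 1` on a dyadic block, times the `1 /
  -- 2` of `sq_half_le_sum`.
  refine ⟨Real.exp (-2 * C) * (1 / 16), by positivity, fun m hm => ?_⟩
  have hm0 : (0 : ℝ) < m := by exact_mod_cast Nat.pos_of_ne_zero hm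
  have hm1 : (1 : ℝ) ≤ m := by exact_mod_cast Nat.pos_of_ne_zero hm
  have hlm : 0 ≤ Real.log m := Real.log_nonneg hm1
  refine le_trans ?_ (hitTime_two_mul_ge hp m)
  rcases le_total 1 κ with hk | hk
  · have hterm : ∀ j ∈ Finset.range m, Real.exp (-2 * C) * (m : ℝ) ^ (κ - 2 * δ)
        ≤ crossTime p (m + j) := by
      intro j _
      refine le_trans ?_ (crossTime_ge hp hp1 (m + j))
      refine le_trans ?_ (Finset.single_le_sum (fun z _ => (Real.exp_pos _).le)
        (Finset.mem_range.2 (Nat.succ_pos _) : 0 ∈ Finset.range (m + j + 1)))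
      rw [Real.rpow_def_of_pos hm0, ← Real.exp_add]
      refine Real.exp_le_exp.2 ?_
      have h1 := (abs_le.1 (h (m + j))).1
      have h2 : potential p 0 = 0 := by simp [potential]
      have h3 : Real.log m ≤ Real.log (((m + j : ℕ) : ℝ) + 1) :=
        Real.log_le_log hm0 (by push_cast; linarith [(Nat.cast_nonneg j : (0 : ℝ) ≤ j)])
      have h4 : 0 ≤ (κ - δ) * (Real.log (((m + j : ℕ) : ℝ) + 1) - Real.log m) :=
        mul_nonneg (by linarith) (by linarith)
      rw [h2]
      nlinarith
    have hmax : max (κ + 1) 2 - 2 * δ = 1 + (κ - 2 * δ) := by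
      rw [max_eq_left (by linarith)]; ring
    refine le_trans ?_ (Finset.sum_le_sum hterm)
    rw [Finset.sum_const, Finset.card_range, nsmul_eq_mul, hmax, Real.rpow_add hm0, Real.rpow_one]
    have : 0 ≤ Real.exp (-2 * C) * (m * (m : ℝ) ^ (κ - 2 * δ)) := by positivity
    linarith
  · have hlog2 : Real.log (2 * m) = Real.log 2 + Real.log m :=
      Real.log_mul two_ne_zero hm0.ne'
    have hl2 : 0 < Real.log 2 := Real.log_pos one_lt_two
    have hexp2 : Real.exp (-3 * Real.log 2) = 1 / 8 := by
      rw [show -3 * Real.log 2 = -Real.log (2 ^ 3) by rw [Real.log_pow]; push_cast; ring,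
        Real.exp_neg, Real.exp_log (by positivity)]
      norm_num
    have hpair : ∀ j ∈ Finset.range m, ∀ k ≤ j, Real.exp (-2 * C) * (1 / 8) * (m : ℝ) ^ (-2 * δ)
        ≤ Real.exp (potential p (m + j) - potential p (m + k)) := by
      intro j hj k hk'
      have hjm : (j : ℝ) + 1 ≤ m := by exact_mod_cast Finset.mem_range.1 hj
      have hkj : (k : ℝ) ≤ j := by exact_mod_cast hk'
      have hk0 : (0 : ℝ) ≤ k := Nat.cast_nonneg k
      rw [← hexp2, Real.rpow_def_of_pos hm0, ← Real.exp_add, ← Real.exp_add]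
      refine Real.exp_le_exp.2 ?_
      have h1 := (abs_le.1 (h (m + j))).1
      have h2 := (abs_le.1 (h (m + k))).2
      push_cast at h1 h2
      set a := Real.log ((m : ℝ) + j + 1)
      set b := Real.log ((m : ℝ) + k + 1)
      have h3 : b ≤ a := Real.log_le_log (by positivity) (by linarith)
      have h4 : a ≤ Real.log 2 + Real.log m := by
        rw [← hlog2]; exact Real.log_le_log (by positivity) (by linarith)
      have h5 : Real.log m ≤ b := Real.log_le_log hm0 (by linarith)
      have h6 : 0 ≤ (κ + 1) * (a - b) := mul_nonneg (by linarith) (by linarith)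
      have h7 : 0 ≤ δ * (Real.log 2 + Real.log m - a) := mul_nonneg hδ.le (by linarith)
      have h8 : 0 ≤ δ * (Real.log 2 + Real.log m - b) := mul_nonneg hδ.le (by linarith)
      have h9 : 0 ≤ (1 - δ) * Real.log 2 := mul_nonneg (by linarith) hl2.le
      nlinarith
    have hterm : ∀ j ∈ Finset.range m,
        ((j : ℝ) + 1) * (Real.exp (-2 * C) * (1 / 8) * (m : ℝ) ^ (-2 * δ))
          ≤ crossTime p (m + j) := by
      intro j hj
      refine le_trans ?_ (crossTime_ge hp hp1 (m + j))
      rw [add_assoc, Finset.sum_range_add]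
      refine le_trans ?_ (le_add_of_nonneg_left (Finset.sum_nonneg fun z _ => (Real.exp_pos _).le))
      calc _ = ∑ k ∈ Finset.range (j + 1),
            Real.exp (-2 * C) * (1 / 8) * (m : ℝ) ^ (-2 * δ) := by
              rw [Finset.sum_const, Finset.card_range, nsmul_eq_mul, Nat.cast_succ]
        _ ≤ _ := Finset.sum_le_sum fun k hk' =>
              hpair j hj k (Nat.lt_succ_iff.1 (Finset.mem_range.1 hk'))
    have hmax : max (κ + 1) 2 - 2 * δ = 2 + -2 * δ := by
      rw [max_eq_right (by linarith)]; ring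
    refine le_trans ?_ (Finset.sum_le_sum hterm)
    rw [← Finset.sum_mul, hmax, Real.rpow_add hm0, Real.rpow_two]
    have h1 := mul_le_mul_of_nonneg_right (sq_half_le_sum m)
      (by positivity : 0 ≤ Real.exp (-2 * C) * (1 / 8) * (m : ℝ) ^ (-2 * δ))
    linarith

/-! ### Almost sure bounds for independent variables -/

section Martingale

variable {Ω : Type*} [MeasurableSpace Ω] {μ : Measure Ω} [IsProbabilityMeasure μ]

/-- Products of independent nonnegative variables of mean at most one are a.s. bounded. -/
lemma ae_bddAbove_prod {Z : ℕ → Ω → ℝ} (hm : ∀ n, Measurable (Z n)) (hi : iIndepFun Z μ)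
    {B : ℝ} (h0 : ∀ n, ∀ᵐ ω ∂μ, 0 ≤ Z n ω) (hB : ∀ n, ∀ᵐ ω ∂μ, Z n ω ≤ B)
    (h1 : ∀ n, ∫ ω, Z n ω ∂μ ≤ 1) :
    ∀ᵐ ω ∂μ, ∃ C : ℝ, ∀ n, ∏ u ∈ Finset.range n, Z u ω ≤ C := by
  -- The product has `n + 1` factors so that `N n` is measurable at stage `n` of the natural
  -- filtration.
  set N : ℕ → Ω → ℝ := fun n ω => ∏ u ∈ Finset.range (n + 1), Z u ω with hN
  have hs : ∀ n, StronglyMeasurable (Z n) := fun n => (hm n).stronglyMeasurable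
  set ℱ := Filtration.natural Z hs with hℱ
  have hZad : StronglyAdapted ℱ Z := Filtration.stronglyAdapted_natural hs
  have had : StronglyAdapted ℱ N := fun n =>
    Finset.stronglyMeasurable_fun_prod _ fun u hu =>
      (hZad u).mono (ℱ.mono (Nat.lt_succ_iff.1 (Finset.mem_range.1 hu)))
  have hN0 : ∀ n, ∀ᵐ ω ∂μ, 0 ≤ N n ω := fun n => by
    filter_upwards [ae_all_iff.2 h0] with ω hω
    exact Finset.prod_nonneg fun u _ => hω u
  have hmeas : ∀ n, Measurable (N n) := fun n => Finset.measurable_fun_prod _ fun u _ => hm u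
  have hint : ∀ n, Integrable (N n) μ := fun n => by
    refine Integrable.of_bound (hmeas n).aestronglyMeasurable (B ^ (n + 1)) ?_
    filter_upwards [ae_all_iff.2 h0, ae_all_iff.2 hB, hN0 n] with ω hω hBω hNω
    rw [Real.norm_of_nonneg hNω]
    refine (Finset.prod_le_prod (fun u _ => hω u) fun u _ => hBω u).trans ?_
    simp
  have hZint : ∀ n, Integrable (Z n) μ := fun n => by
    refine Integrable.of_bound (hm n).aestronglyMeasurable B ?_
    filter_upwards [h0 n, hB n] with ω hω hBω
    rwa [Real.norm_of_nonneg hω]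
  have hsucc : ∀ n, N (n + 1) = N n * Z (n + 1) := fun n => by
    ext ω; simp only [hN, Finset.prod_range_succ _ (n + 1), Pi.mul_apply]
  have hsuper : Supermartingale N ℱ μ := by
    refine supermartingale_nat had hint fun n => ?_
    have hc := condExp_mul_of_stronglyMeasurable_left (μ := μ) (had n)
      (hsucc n ▸ hint (n + 1)) (hZint (n + 1))
    rw [hsucc n]
    filter_upwards [hc, iIndepFun.condExp_natural_ae_eq_of_lt hs hi (Nat.lt_succ_self n), hN0 n]
      with ω e1 e2 e3
    rw [e1, Pi.mul_apply, e2]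
    exact mul_le_of_le_one_right e3 (h1 (n + 1))
  have hle : ∀ n, ∫ ω, N n ω ∂μ ≤ 1 := fun n => by
    have h := hsuper.setIntegral_le (Nat.zero_le n) MeasurableSet.univ
    simp only [setIntegral_univ] at h
    refine h.trans ?_
    simpa [hN] using h1 0
  -- The negated process is an L¹-bounded submartingale, hence converges almost surely and has
  -- bounded paths.
  have hconv := hsuper.neg.ae_tendsto_limitProcess (R := 1) fun n => by
    rw [eLpNorm_one_eq_lintegral_enorm]
    have : ∫⁻ ω, ‖(-N) n ω‖ₑ ∂μ = ∫⁻ ω, ENNReal.ofReal (N n ω) ∂μ := by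
      refine lintegral_congr_ae ?_
      filter_upwards [hN0 n] with ω hω
      simp only [Pi.neg_apply, enorm_neg]
      rw [Real.enorm_of_nonneg hω]
    rw [this, ← ofReal_integral_eq_lintegral_ofReal (hint n) (hN0 n)]
    simpa using hle n
  filter_upwards [hconv] with ω hω
  obtain ⟨C, hC⟩ := hω.bddBelow_range
  refine ⟨max 1 (-C), fun n => ?_⟩
  cases n with
  | zero => simp
  | succ n =>
    have := hC ⟨n, rfl⟩
    refine le_trans ?_ (le_max_right _ _)
    have h2 : -(∏ u ∈ Finset.range (n + 1), Z u ω) = (-N) n ω := rfl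
    linarith

/-- Partial sums of independent centred variables bounded by one are a.s. at most the partial
sums of their variances, up to a constant. -/
lemma ae_sum_le_sum_variance {Y : ℕ → Ω → ℝ} (hm : ∀ n, Measurable (Y n)) (hi : iIndepFun Y μ)
    (hY : ∀ n, ∀ᵐ ω ∂μ, |Y n ω| ≤ 1) (h0 : ∀ n, ∫ ω, Y n ω ∂μ = 0) {v : ℕ → ℝ}
    (hv : ∀ n, ∫ ω, Y n ω ^ 2 ∂μ ≤ v n) :
    ∀ᵐ ω ∂μ, ∃ C : ℝ, ∀ n, ∑ u ∈ Finset.range n, Y u ω ≤ ∑ u ∈ Finset.range n, v u + C := by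
  have hv0 : ∀ n, 0 ≤ v n := fun n => (integral_nonneg fun ω => sq_nonneg _).trans (hv n)
  have hg : ∀ n, Measurable fun x : ℝ => Real.exp (x - v n) := fun n => by fun_prop
  have hi' : iIndepFun (fun n ω => Real.exp (Y n ω - v n)) μ :=
    hi.comp (fun n x => Real.exp (x - v n)) hg
  have hYint : ∀ n, Integrable (Y n) μ := fun n =>
    Integrable.of_bound (hm n).aestronglyMeasurable 1 (by simpa using hY n)
  have hY2int : ∀ n, Integrable (fun ω => Y n ω ^ 2) μ := fun n => by
    refine Integrable.of_bound ((hm n).pow_const 2).aestronglyMeasurable 1 ?_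
    filter_upwards [hY n] with ω hω
    rw [Real.norm_of_nonneg (sq_nonneg _), ← sq_abs]
    exact pow_le_one₀ (abs_nonneg _) hω
  have hexp : ∀ n, Integrable (fun ω => Real.exp (Y n ω)) μ := fun n => by
    refine Integrable.of_bound (hm n).exp.aestronglyMeasurable (Real.exp 1) ?_
    filter_upwards [hY n] with ω hω
    rw [Real.norm_of_nonneg (Real.exp_pos _).le]
    exact Real.exp_le_exp.2 (le_of_abs_le hω)
  have h1 : ∀ n, ∫ ω, Real.exp (Y n ω - v n) ∂μ ≤ 1 := fun n => by
    simp only [Real.exp_sub, integral_div]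
    rw [div_le_one (Real.exp_pos _)]
    -- From `exp y ≤ 1 + y + y ^ 2` for `|y| ≤ 1`, the exponential moment is at most `1 + v n ≤ exp
    -- (v n)`, so the factors `exp (Y n - v n)` have mean at most one.
    have hle : ∫ ω, Real.exp (Y n ω) ∂μ ≤ ∫ ω, (1 + Y n ω + Y n ω ^ 2) ∂μ := by
      refine integral_mono_ae (hexp n) (((integrable_const 1).add (hYint n)).add (hY2int n)) ?_
      filter_upwards [hY n] with ω hω
      have := (abs_le.1 (Real.abs_exp_sub_one_sub_id_le hω)).2
      linarith
    have hadd : Integrable (fun ω => 1 + Y n ω) μ := (integrable_const 1).add (hYint n)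
    rw [integral_add hadd (hY2int n), integral_add (integrable_const 1) (hYint n), h0 n] at hle
    simp only [integral_const, probReal_univ, smul_eq_mul, mul_one, add_zero] at hle
    linarith [hv n, Real.add_one_le_exp (v n)]
  have h := ae_bddAbove_prod (fun n => (hg n).comp (hm n)) hi' (B := Real.exp 1)
    (fun n => ae_of_all _ fun ω => (Real.exp_pos _).le) (fun n => by
      filter_upwards [hY n] with ω hω
      refine Real.exp_le_exp.2 ?_
      linarith [le_of_abs_le hω, hv0 n]) h1
  filter_upwards [h] with ω hω
  obtain ⟨C, hC⟩ := hω
  have hC0 : 0 < C := lt_of_lt_of_le zero_lt_one (by simpa using hC 0)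
  refine ⟨Real.log C, fun n => ?_⟩
  have := hC n
  simp only [Function.comp] at this
  rw [← Real.exp_sum, Finset.sum_sub_distrib, ← Real.le_log_iff_exp_le hC0] at this
  linarith

lemma ae_summable_of_summable_integral {Ω : Type*} [MeasurableSpace Ω] {μ : Measure Ω}
    {f : ℕ → Ω → ℝ} (hm : ∀ n, Measurable (f n))
    (h0 : ∀ n ω, 0 ≤ f n ω) (hi : ∀ n, Integrable (f n) μ)
    (hs : Summable fun n => ∫ ω, f n ω ∂μ) : ∀ᵐ ω ∂μ, Summable fun n => f n ω := by
  have hm' : ∀ n, Measurable fun ω => ENNReal.ofReal (f n ω) := fun n => (hm n).ennreal_ofReal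
  have hfin : ∫⁻ ω, ∑' n, ENNReal.ofReal (f n ω) ∂μ ≠ ⊤ := by
    rw [lintegral_tsum fun n => (hm' n).aemeasurable]
    simp only [← ofReal_integral_eq_lintegral_ofReal (hi _) (ae_of_all _ (h0 _))]
    rw [← ENNReal.ofReal_tsum_of_nonneg (fun n => integral_nonneg (h0 n)) hs]
    exact ENNReal.ofReal_ne_top
  filter_upwards [ae_lt_top (Measurable.tsum hm') hfin] with ω hω
  have := ENNReal.summable_toReal hω.ne
  simpa [ENNReal.toReal_ofReal (h0 _ _)] using this

end Martingale

/-! ### Expansion of the potential increment and Beta moments -/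

/-- The logarithm is `log (1 - 2q) - log (1 + 2q)`, in which the quadratic terms cancel. The error
is thus cubic, and cubes, unlike squares, turn out to be summable along the environment. -/
lemma abs_log_ratio_add_le {q : ℝ} (hq : |q| ≤ 1 / 4) :
    |Real.log ((1 / 2 - q) / (1 / 2 + q)) + 4 * q| ≤ 32 * |q| ^ 3 := by
  obtain ⟨h1, h2⟩ := abs_le.1 hq
  have hx : |2 * q| ≤ 1 / 2 := by rw [abs_mul, abs_two]; linarith
  have key : ∀ x : ℝ, |x| ≤ 1 / 2 → |x + x ^ 2 / 2 + Real.log (1 - x)| ≤ 2 * |x| ^ 3 := by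
    intro x hx
    have h := Real.abs_log_sub_add_sum_range_le (x := x) (by linarith) 2
    have e : ∑ i ∈ Finset.range 2, x ^ (i + 1) / ((i : ℝ) + 1) = x + x ^ 2 / 2 := by
      simp [Finset.sum_range_succ]; norm_num
    rw [e] at h
    refine h.trans ?_
    rw [div_le_iff₀ (by linarith)]
    have : 0 ≤ |x| ^ 3 := by positivity
    norm_num
    nlinarith
  have k1 := key (2 * q) hx
  have k2 := key (-(2 * q)) (by rwa [abs_neg])
  have e : Real.log ((1 / 2 - q) / (1 / 2 + q)) = Real.log (1 - 2 * q) - Real.log (1 - -(2 * q)) := by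
    rw [← Real.log_div (by linarith) (by linarith)]
    congr 1
    rw [div_eq_div_iff (by linarith) (by linarith)]
    ring
  rw [abs_neg] at k2
  have e3 : |2 * q| ^ 3 = 8 * |q| ^ 3 := by rw [abs_mul, abs_two]; ring
  rw [e3] at k1 k2
  rw [e, abs_le]
  rw [abs_le] at k1 k2
  constructor <;> nlinarith

section BetaMoments

variable {a b : ℝ}

lemma beta_comm (a b : ℝ) : beta a b = beta b a := by
  rw [beta, beta, mul_comm, add_comm]

lemma beta_add_one_right (ha : 0 < a) (hb : 0 < b) : beta a (b + 1) = b / (a + b) * beta a b := by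
  rw [beta_comm, beta_add_one_left hb ha, beta_comm b, add_comm b]

lemma integrable_betaMeasure (ha : 0 < a) (hb : 0 < b) {g : ℝ → ℝ} (hg : Continuous g) :
    Integrable g (betaMeasure a b) := by
  have := isProbabilityMeasureBeta ha hb
  obtain ⟨C, hC⟩ := (isCompact_Icc (a := (0 : ℝ)) (b := 1)).exists_bound_of_continuousOn
    hg.continuousOn
  refine Integrable.of_bound hg.aestronglyMeasurable C ?_
  filter_upwards [betaMeasure_ae_mem_Ioo a b] with x hx using hC x ⟨hx.1.le, hx.2.le⟩

lemma integral_betaMeasure_id (ha : 0 < a) (hb : 0 < b) :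
    ∫ x, x ∂betaMeasure a b = a / (a + b) := by
  have := isProbabilityMeasureBeta ha hb
  simpa using integral_betaMeasure_mul_monomial ha hb 0 0

lemma integral_betaMeasure_one_one (ha : 0 < a) (hb : 0 < b) :
    ∫ x, x * (1 - x) ∂betaMeasure a b = a * b / ((a + b) * (a + b + 1)) := by
  have h := integral_betaMeasure_monomial ha hb 1 1
  simp only [pow_one, Nat.cast_one] at h
  have h1 := (beta_pos ha hb).ne'
  rw [h, beta_add_one_left ha (by positivity), beta_add_one_right ha hb]
  field_simp
  ring

lemma integral_betaMeasure_two_two (ha : 0 < a) (hb : 0 < b) :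
    ∫ x, x ^ 2 * (1 - x) ^ 2 ∂betaMeasure a b = a * (a + 1) * (b * (b + 1))
      / ((a + b) * (a + b + 1) * (a + b + 2) * (a + b + 3)) := by
  have h := integral_betaMeasure_monomial ha hb 2 2
  have h1 := (beta_pos ha hb).ne'
  have e : ∀ t : ℝ, t + (2 : ℕ) = t + 1 + 1 := fun t => by push_cast; ring
  rw [h, e, e, beta_add_one_left (by positivity) (by positivity),
    beta_add_one_left ha (by positivity), beta_add_one_right ha (by positivity),
    beta_add_one_right ha hb]
  field_simp
  ring

lemma integral_betaMeasure_sq_le (ha : 0 < a) (hb : 0 < b) :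
    ∫ x, (x - 1 / 2) ^ 2 ∂betaMeasure a b ≤ (1 + (a - b) ^ 2) / (a + b) := by
  have := isProbabilityMeasureBeta ha hb
  have e : ∀ x : ℝ, (x - 1 / 2) ^ 2 = 1 / 4 - x * (1 - x) := fun x => by ring
  simp only [e]
  rw [integral_sub (integrable_const _) (integrable_betaMeasure ha hb (by fun_prop)),
    integral_betaMeasure_one_one ha hb]
  simp only [integral_const, probReal_univ, smul_eq_mul, one_mul]
  rw [div_sub_div _ _ (by norm_num) (by positivity), div_le_div_iff₀ (by positivity) (by positivity)]
  have hs : 0 < a + b := by positivity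
  have hd := sq_nonneg (a - b)
  have : 0 ≤ (a + b) * ((a + b) * 3 + 4 + (a - b) ^ 2 * (4 * (a + b) + 3)) := by positivity
  nlinarith

lemma integral_betaMeasure_fourth_le (ha : 0 < a) (hb : 0 < b) :
    ∫ x, (x - 1 / 2) ^ 4 ∂betaMeasure a b
      ≤ (1 + (a - b) ^ 2 + (a - b) ^ 4) / (a + b) ^ 2 := by
  have := isProbabilityMeasureBeta ha hb
  have e : ∀ x : ℝ, (x - 1 / 2) ^ 4 = 1 / 16 - 1 / 2 * (x * (1 - x)) + x ^ 2 * (1 - x) ^ 2 :=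
    fun x => by ring
  simp only [e]
  rw [integral_add (integrable_betaMeasure ha hb (by fun_prop))
      (integrable_betaMeasure ha hb (by fun_prop)),
    integral_sub (integrable_const _) (integrable_betaMeasure ha hb (by fun_prop)),
    integral_const_mul, integral_betaMeasure_one_one ha hb, integral_betaMeasure_two_two ha hb]
  simp only [integral_const, probReal_univ, smul_eq_mul, one_mul]
  -- In the sum `s` and difference `d` of the parameters, the claim becomes nonnegativity of a
  -- polynomial with positive coefficients and even powers of `d`.
  obtain ⟨s, hs⟩ : ∃ s, s = a + b := ⟨_, rfl⟩
  obtain ⟨d, hd⟩ : ∃ d, d = a - b := ⟨_, rfl⟩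
  have hs0 : 0 < s := by rw [hs]; positivity
  obtain rfl : a = (s + d) / 2 := by linarith
  obtain rfl : b = (s - d) / 2 := by linarith
  rw [← hs, ← hd]
  have e2 : 1 / 16 - 1 / 2 * ((s + d) / 2 * ((s - d) / 2) / (s * (s + 1)))
      + (s + d) / 2 * ((s + d) / 2 + 1) * ((s - d) / 2 * ((s - d) / 2 + 1))
        / (s * (s + 1) * (s + 2) * (s + 3))
      = (3 * s ^ 2 + 6 * s * (1 + d ^ 2) + 8 * d ^ 2 + d ^ 4)
        / (16 * (s * (s + 1) * (s + 2) * (s + 3))) := by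
    field_simp
    ring
  rw [e2, div_le_div_iff₀ (by positivity) (by positivity), ← sub_nonneg]
  have e3 : (1 + d ^ 2 + d ^ 4) * (16 * (s * (s + 1) * (s + 2) * (s + 3)))
      - (3 * s ^ 2 + 6 * s * (1 + d ^ 2) + 8 * d ^ 2 + d ^ 4) * s ^ 2
      = s * (13 * s ^ 3 + 90 * s ^ 2 + 176 * s + 96
        + d ^ 2 * (16 * s ^ 3 + 90 * s ^ 2 + 168 * s + 96)
        + d ^ 4 * (16 * s ^ 3 + 96 * s ^ 2 + 175 * s + 96)) := by ring
  rw [e3]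
  positivity

end BetaMoments

lemma powerWeight_one_of_ne_zero {y : ℕ} (hy : y ≠ 0) : powerWeight 1 y = y := by
  rw [powerWeight, if_neg hy, Real.rpow_one]

lemma powerWeight_pos (α : ℝ) (y : ℕ) : 0 < powerWeight α y := by
  unfold powerWeight
  split_ifs with h
  · exact one_pos
  · exact Real.rpow_pos_of_pos (by exact_mod_cast Nat.pos_of_ne_zero h) α

lemma abs_harmonic_sub_log_le (n : ℕ) :
    |∑ u ∈ Finset.range n, (1 : ℝ) / (u + 1) - Real.log (n + 1)| ≤ 1 := by
  have h : ((harmonic n : ℚ) : ℝ) = ∑ u ∈ Finset.range n, (1 : ℝ) / (u + 1) := by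
    simp [harmonic]
  have h1 := log_add_one_le_harmonic n
  have h2 := harmonic_le_one_add_log n
  rw [h] at h1 h2
  have h3 : Real.log n ≤ Real.log (n + 1) := by
    rcases Nat.eq_zero_or_pos n with rfl | hn
    · simp
    · exact Real.log_le_log (by exact_mod_cast hn) (by linarith)
  push_cast at h1
  rw [abs_le]
  constructor <;> linarith

/-! ### Moments of the step probability at one site -/

section Site

variable {Δ : ℝ}

/-- The parameters differ by `(1 - Δ) / (2Δ)`, except at site `1`, where the weight `1` of the edge
at the origin makes the difference `-1/2`. Since their sum grows linearly, second and fourth moments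
about `1/2` decay like `1/u` and `1/u²`. -/
lemma params_sub_sq_le (hΔ : 0 < Δ) (u : ℕ) :
    (rightParam (powerWeight 1) Δ (u + 1) - leftParam (powerWeight 1) Δ (u + 1)) ^ 2
      ≤ 1 / 4 + ((1 - Δ) / (2 * Δ)) ^ 2 := by
  rw [rightParam, leftParam, powerWeight_one_of_ne_zero u.succ_ne_zero, Nat.add_sub_cancel]
  cases u with
  | zero =>
    have : (((0 + 1 : ℕ) : ℝ)) / (2 * Δ) - (powerWeight 1 0 + Δ) / (2 * Δ) = -(1 / 2) := by
      rw [powerWeight, if_pos rfl]; field_simp; push_cast; ring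
    rw [this]
    nlinarith [sq_nonneg ((1 - Δ) / (2 * Δ))]
  | succ u =>
    have : (((u + 1 + 1 : ℕ) : ℝ)) / (2 * Δ) - (powerWeight 1 (u + 1) + Δ) / (2 * Δ)
        = (1 - Δ) / (2 * Δ) := by
      rw [powerWeight_one_of_ne_zero u.succ_ne_zero]; field_simp; push_cast; ring
    rw [this]
    linarith

lemma params_add_ge (hΔ : 0 < Δ) (u : ℕ) : ((u : ℝ) + 1) / (2 * Δ)
    ≤ rightParam (powerWeight 1) Δ (u + 1) + leftParam (powerWeight 1) Δ (u + 1) := by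
  have h := leftParam_pos (powerWeight_pos 1) hΔ (u + 1)
  have h2 : rightParam (powerWeight 1) Δ (u + 1) = ((u : ℝ) + 1) / (2 * Δ) := by
    rw [rightParam, powerWeight_one_of_ne_zero u.succ_ne_zero, Nat.cast_succ]
  linarith

lemma siteMeasure_succ (w : ℕ → ℝ) (Δ : ℝ) (u : ℕ) : siteMeasure w Δ (u + 1)
    = betaMeasure (rightParam w Δ (u + 1)) (leftParam w Δ (u + 1)) := by
  rw [siteMeasure, if_neg u.succ_ne_zero]

lemma exists_integral_sq_le (hΔ : 0 < Δ) : ∃ K : ℝ, 0 ≤ K ∧ ∀ u : ℕ,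
    ∫ x, (x - 1 / 2) ^ 2 ∂siteMeasure (powerWeight 1) Δ (u + 1) ≤ K / (u + 1) := by
  refine ⟨(1 + (1 / 4 + ((1 - Δ) / (2 * Δ)) ^ 2)) * (2 * Δ), by positivity, fun u => ?_⟩
  have ha := rightParam_pos (powerWeight_pos 1) hΔ (u + 1)
  have hb := leftParam_pos (powerWeight_pos 1) hΔ (u + 1)
  rw [siteMeasure_succ]
  refine (integral_betaMeasure_sq_le ha hb).trans ?_
  have h1 := params_sub_sq_le hΔ u
  have h2 := params_add_ge hΔ u
  calc _ ≤ (1 + (1 / 4 + ((1 - Δ) / (2 * Δ)) ^ 2)) / (((u : ℝ) + 1) / (2 * Δ)) := by gcongr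
    _ = _ := by field_simp

lemma exists_integral_fourth_le (hΔ : 0 < Δ) : ∃ K : ℝ, 0 ≤ K ∧ ∀ u : ℕ,
    ∫ x, (x - 1 / 2) ^ 4 ∂siteMeasure (powerWeight 1) Δ (u + 1) ≤ K / ((u : ℝ) + 1) ^ 2 := by
  set D := 1 / 4 + ((1 - Δ) / (2 * Δ)) ^ 2
  refine ⟨(1 + D + D ^ 2) * (2 * Δ) ^ 2, by positivity, fun u => ?_⟩
  have ha := rightParam_pos (powerWeight_pos 1) hΔ (u + 1)
  have hb := leftParam_pos (powerWeight_pos 1) hΔ (u + 1)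
  rw [siteMeasure_succ]
  refine (integral_betaMeasure_fourth_le ha hb).trans ?_
  have h1 := params_sub_sq_le hΔ u
  have h2 := params_add_ge hΔ u
  have h3 : (rightParam (powerWeight 1) Δ (u + 1) - leftParam (powerWeight 1) Δ (u + 1)) ^ 4
      ≤ D ^ 2 := by
    rw [show 4 = 2 * 2 from rfl, pow_mul]
    exact pow_le_pow_left₀ (sq_nonneg _) h1 2
  calc _ ≤ (1 + D + D ^ 2) / (((u : ℝ) + 1) / (2 * Δ)) ^ 2 := by gcongr
    _ = _ := by field_simp

lemma integral_sub_half (hΔ : 0 < Δ) (u : ℕ) :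
    ∫ x, (x - 1 / 2) ∂siteMeasure (powerWeight 1) Δ (u + 1)
      = rightParam (powerWeight 1) Δ (u + 1)
        / (rightParam (powerWeight 1) Δ (u + 1) + leftParam (powerWeight 1) Δ (u + 1)) - 1 / 2 := by
  have ha := rightParam_pos (powerWeight_pos 1) hΔ (u + 1)
  have hb := leftParam_pos (powerWeight_pos 1) hΔ (u + 1)
  have := isProbabilityMeasureBeta ha hb
  have hid : Integrable (fun x : ℝ => x) (betaMeasure (rightParam (powerWeight 1) Δ (u + 1))
    (leftParam (powerWeight 1) Δ (u + 1))) := integrable_betaMeasure ha hb continuous_id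
  rw [siteMeasure_succ, integral_sub hid (integrable_const _), integral_betaMeasure_id ha hb]
  simp

/-- This identifies the slope `Δ - 1` of the potential. Away from site `1` the mean is explicit and
the error is `(Δ - 1) ^ 2` over a product of two linear factors; `B` absorbs site `1`. -/
lemma exists_abs_mean_le (hΔ : 0 < Δ) : ∃ K : ℝ, ∀ u : ℕ,
    |-4 * ∫ x, (x - 1 / 2) ∂siteMeasure (powerWeight 1) Δ (u + 1) - (Δ - 1) * (1 / ((u : ℝ) + 1))|
      ≤ K * (1 / ((u : ℝ) + 1) ^ 2) := by
  set B := |-4 * ∫ x, (x - 1 / 2) ∂siteMeasure (powerWeight 1) Δ (0 + 1)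
    - (Δ - 1) * (1 / (((0 : ℕ) : ℝ) + 1))| with hB
  refine ⟨(Δ - 1) ^ 2 + B, fun u => ?_⟩
  cases u with
  | zero => rw [← hB]; norm_num; positivity
  | succ u =>
    have hu : (0 : ℝ) ≤ u := Nat.cast_nonneg u
    rw [integral_sub_half hΔ, rightParam, leftParam,
      powerWeight_one_of_ne_zero (Nat.succ_ne_zero _), Nat.add_sub_cancel,
      powerWeight_one_of_ne_zero (Nat.succ_ne_zero _)]
    push_cast
    have hpos : 0 < 2 * (u : ℝ) + 3 + Δ := by positivity
    have e : -4 * (((u : ℝ) + 1 + 1) / (2 * Δ)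
        / (((u : ℝ) + 1 + 1) / (2 * Δ) + ((u : ℝ) + 1 + Δ) / (2 * Δ)) - 1 / 2)
        - (Δ - 1) * (1 / ((u : ℝ) + 1 + 1))
        = -((Δ - 1) ^ 2 * (1 / (((u : ℝ) + 1 + 1) * (2 * u + 3 + Δ)))) := by
      rw [← add_div, div_div_div_cancel_right₀ (by positivity),
        show (u : ℝ) + 1 + 1 + ((u : ℝ) + 1 + Δ) = 2 * u + 3 + Δ by ring]
      field_simp
      ring
    rw [e, abs_neg, abs_of_nonneg (by positivity), add_mul ((Δ - 1) ^ 2) B]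
    have hB0 : 0 ≤ B * (1 / ((u : ℝ) + 1 + 1) ^ 2) := by positivity
    refine le_trans ?_ (le_add_of_nonneg_right hB0)
    refine mul_le_mul_of_nonneg_left ?_ (sq_nonneg _)
    refine one_div_le_one_div_of_le (by positivity) ?_
    rw [sq]
    refine mul_le_mul_of_nonneg_left ?_ (by positivity)
    linarith

end Site

/-! ### The potential of a typical environment is logarithmic -/

section Env

variable {Δ : ℝ}

lemma ae_abs_sub_half_le (hΔ : 0 < Δ) :
    ∀ᵐ p ∂envMeasure (powerWeight 1) Δ, ∀ y, |p y - 1 / 2| ≤ 1 / 2 := by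
  filter_upwards [envMeasure_ae_isEnv (powerWeight_pos 1) hΔ] with p hp y
  rw [abs_le]
  constructor <;> linarith [hp.1.pos y, hp.1.le_one y]

/-- The centred step probabilities have logarithmically negligible partial sums. -/
lemma ae_sum_centred_le (hΔ : 0 < Δ) {K : ℝ} (hK : ∀ u : ℕ,
      ∫ x, (x - 1 / 2) ^ 2 ∂siteMeasure (powerWeight 1) Δ (u + 1) ≤ K / (u + 1))
    {θ : ℝ} (hθ : |θ| ≤ 1) :
    ∀ᵐ p ∂envMeasure (powerWeight 1) Δ, ∃ C : ℝ, ∀ n : ℕ,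
      θ * ∑ u ∈ Finset.range n, (p (u + 1) - 1 / 2
        - ∫ x, (x - 1 / 2) ∂siteMeasure (powerWeight 1) Δ (u + 1))
      ≤ θ ^ 2 * K * ∑ u ∈ Finset.range n, 1 / ((u : ℝ) + 1) + C := by
  have hw := powerWeight_pos 1
  have := isProbabilityMeasure_envMeasure hw hΔ
  set M : ℕ → ℝ := fun u => ∫ x, (x - 1 / 2) ∂siteMeasure (powerWeight 1) Δ (u + 1) with hM
  have hMe : ∀ u, M u = ∫ p : ℕ → ℝ, (p (u + 1) - 1 / 2) ∂envMeasure (powerWeight 1) Δ := fun u =>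
    (integral_envMeasure_eval hw hΔ (u + 1) (g := fun x => x - 1 / 2) (by fun_prop)).symm
  have hint : ∀ u : ℕ, Integrable (fun p : ℕ → ℝ => p (u + 1) - 1 / 2)
      (envMeasure (powerWeight 1) Δ) := fun u => by
    refine Integrable.of_bound (Measurable.aestronglyMeasurable (by fun_prop)) (1 / 2) ?_
    filter_upwards [ae_abs_sub_half_le hΔ] with p hp using hp (u + 1)
  have hint2 : ∀ u : ℕ, Integrable (fun p : ℕ → ℝ => (p (u + 1) - 1 / 2) ^ 2)
      (envMeasure (powerWeight 1) Δ) := fun u => by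
    refine Integrable.of_bound (Measurable.aestronglyMeasurable (by fun_prop)) 1 ?_
    filter_upwards [ae_abs_sub_half_le hΔ] with p hp
    rw [Real.norm_of_nonneg (sq_nonneg _), ← sq_abs]
    exact pow_le_one₀ (abs_nonneg _) ((hp (u + 1)).trans (by norm_num))
  have hM1 : ∀ u, |M u| ≤ 1 / 2 := fun u => by
    rw [hMe]
    have h := norm_integral_le_of_norm_le_const (μ := envMeasure (powerWeight 1) Δ)
      (f := fun p : ℕ → ℝ => p (u + 1) - 1 / 2) (C := 1 / 2) (by
        filter_upwards [ae_abs_sub_half_le hΔ] with p hp using hp (u + 1))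
    simpa using h
  have hi : iIndepFun (fun (u : ℕ) (p : ℕ → ℝ) => θ * (p (u + 1) - 1 / 2 - M u))
      (envMeasure (powerWeight 1) Δ) :=
    ((iIndepFun_envMeasure hw hΔ).precomp (g := fun u : ℕ => u + 1) (add_left_injective 1)).comp
      (fun u x => θ * (x - 1 / 2 - M u)) (fun u => by fun_prop)
  have h := ae_sum_le_sum_variance (fun u => by fun_prop) hi (fun u => by
      filter_upwards [ae_abs_sub_half_le hΔ] with p hp
      rw [abs_mul]
      refine mul_le_one₀ hθ (abs_nonneg _) ((abs_sub _ _).trans ?_)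
      linarith [hp (u + 1), hM1 u]) (fun u => by
      rw [integral_const_mul, integral_sub (hint u) (integrable_const _), ← hMe]
      simp) (v := fun u => θ ^ 2 * (K / (u + 1))) (fun u => by
      simp only [mul_pow]
      rw [integral_const_mul]
      refine mul_le_mul_of_nonneg_left ?_ (sq_nonneg θ)
      -- The variance is the second moment about `1/2` minus `M u ^ 2`, hence at most that moment.
      have e : ∀ p : ℕ → ℝ, (p (u + 1) - 1 / 2 - M u) ^ 2
          = (p (u + 1) - 1 / 2) ^ 2 - 2 * M u * (p (u + 1) - 1 / 2) + M u ^ 2 := fun p => by ring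
      simp only [e]
      have hsub : Integrable (fun p : ℕ → ℝ =>
          (p (u + 1) - 1 / 2) ^ 2 - 2 * M u * (p (u + 1) - 1 / 2))
          (envMeasure (powerWeight 1) Δ) := (hint2 u).sub ((hint u).const_mul _)
      rw [integral_add hsub (integrable_const _), integral_sub (hint2 u) ((hint u).const_mul _), integral_const_mul, ← hMe,
        integral_envMeasure_eval hw hΔ (u + 1) (g := fun x => (x - 1 / 2) ^ 2) (by fun_prop)]
      simp only [integral_const, probReal_univ, smul_eq_mul, one_mul]
      nlinarith [hK u, sq_nonneg (M u)])
  filter_upwards [h] with p hp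
  obtain ⟨C, hC⟩ := hp
  refine ⟨C, fun n => ?_⟩
  have := hC n
  rw [← Finset.mul_sum, ← Finset.mul_sum] at this
  refine this.trans (le_of_eq ?_)
  rw [mul_assoc, Finset.mul_sum _ _ K]
  simp only [mul_one_div]

/-- The cube is dominated by `u ^ (-1/2)` times the square plus `u ^ (1/2)` times the fourth power,
both of expectation `O(u ^ (-3/2))`. -/
lemma ae_summable_abs_cube (hΔ : 0 < Δ) : ∀ᵐ p ∂envMeasure (powerWeight 1) Δ,
    Summable fun u : ℕ => |p (u + 1) - 1 / 2| ^ 3 := by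
  have hw := powerWeight_pos 1
  have := isProbabilityMeasure_envMeasure hw hΔ
  obtain ⟨K, hK0, hK⟩ := exists_integral_sq_le hΔ
  obtain ⟨L, hL0, hL⟩ := exists_integral_fourth_le hΔ
  have hint : ∀ (k u : ℕ), Integrable (fun p : ℕ → ℝ => (p (u + 1) - 1 / 2) ^ k)
      (envMeasure (powerWeight 1) Δ) := fun k u => by
    refine Integrable.of_bound (Measurable.aestronglyMeasurable (by fun_prop)) 1 ?_
    filter_upwards [ae_abs_sub_half_le hΔ] with p hp
    rw [norm_pow]
    exact pow_le_one₀ (norm_nonneg _) ((hp (u + 1)).trans (by norm_num))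
  set f : ℕ → (ℕ → ℝ) → ℝ := fun u p =>
    ((u : ℝ) + 1) ^ (-(1 / 2) : ℝ) * (p (u + 1) - 1 / 2) ^ 2
      + ((u : ℝ) + 1) ^ (1 / 2 : ℝ) * (p (u + 1) - 1 / 2) ^ 4 with hf
  have hfi : ∀ u, Integrable (f u) (envMeasure (powerWeight 1) Δ) := fun u =>
    ((hint 2 u).const_mul _).add ((hint 4 u).const_mul _)
  have hsum : Summable fun u => ∫ p, f u p ∂envMeasure (powerWeight 1) Δ := by
    have hb : Summable fun u : ℕ => (K + L) * ((u + 1 : ℕ) : ℝ) ^ (-(3 / 2) : ℝ) :=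
      ((summable_nat_add_iff 1).2 (Real.summable_nat_rpow.2 (by norm_num))).mul_left _
    refine Summable.of_nonneg_of_le (fun u => integral_nonneg fun p => ?_) (fun u => ?_) hb
    · simp only [hf, Pi.zero_apply]; positivity
    · have hu : (0 : ℝ) < (u : ℝ) + 1 := by positivity
      simp only [hf]
      rw [integral_add ((hint 2 u).const_mul _) ((hint 4 u).const_mul _), integral_const_mul,
        integral_const_mul,
        integral_envMeasure_eval hw hΔ (u + 1) (g := fun x => (x - 1 / 2) ^ 2) (by fun_prop),
        integral_envMeasure_eval hw hΔ (u + 1) (g := fun x => (x - 1 / 2) ^ 4) (by fun_prop),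
        Nat.cast_succ]
      have e1 : ((u : ℝ) + 1) ^ (-(3 / 2) : ℝ)
          = ((u : ℝ) + 1) ^ (-(1 / 2) : ℝ) * (1 / ((u : ℝ) + 1)) := by
        rw [show (-(3 / 2) : ℝ) = -(1 / 2) + -1 by norm_num, Real.rpow_add hu, Real.rpow_neg_one,
          inv_eq_one_div]
      have e2 : ((u : ℝ) + 1) ^ (-(3 / 2) : ℝ)
          = ((u : ℝ) + 1) ^ (1 / 2 : ℝ) * (1 / ((u : ℝ) + 1) ^ 2) := by
        rw [show (-(3 / 2) : ℝ) = 1 / 2 + -2 by norm_num, Real.rpow_add hu, Real.rpow_neg hu.le,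
          Real.rpow_two, inv_eq_one_div]
      have h1 := mul_le_mul_of_nonneg_left (hK u)
        (by positivity : 0 ≤ ((u : ℝ) + 1) ^ (-(1 / 2) : ℝ))
      have h2 := mul_le_mul_of_nonneg_left (hL u)
        (by positivity : 0 ≤ ((u : ℝ) + 1) ^ (1 / 2 : ℝ))
      have h3 : (K + L) * ((u : ℝ) + 1) ^ (-(3 / 2) : ℝ)
          = ((u : ℝ) + 1) ^ (-(1 / 2) : ℝ) * (K / ((u : ℝ) + 1))
            + ((u : ℝ) + 1) ^ (1 / 2 : ℝ) * (L / ((u : ℝ) + 1) ^ 2) := by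
        rw [add_mul]
        nth_rewrite 1 [e1]
        rw [e2]
        ring
      linarith
  have h := ae_summable_of_summable_integral (fun u => by simp only [hf]; fun_prop)
    (fun u p => by simp only [hf]; positivity) hfi hsum
  filter_upwards [h] with p hp
  refine Summable.of_nonneg_of_le (fun u => by positivity) (fun u => ?_) hp
  simp only [hf]
  have hu : (0 : ℝ) < (u : ℝ) + 1 := by positivity
  set q := p (u + 1) - 1 / 2
  set s := ((u : ℝ) + 1) ^ (1 / 4 : ℝ)
  have hs : 0 < s := by positivity
  have e1 : ((u : ℝ) + 1) ^ (1 / 2 : ℝ) = s ^ 2 := by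
    rw [← Real.rpow_natCast, ← Real.rpow_mul hu.le]; norm_num
  have e2 : ((u : ℝ) + 1) ^ (-(1 / 2) : ℝ) = (s⁻¹) ^ 2 := by
    rw [Real.rpow_neg hu.le, e1, inv_pow]
  have e3 : q ^ 4 = |q| ^ 4 := by rw [show 4 = 2 * 2 from rfl, pow_mul, pow_mul, sq_abs]
  rw [e1, e2, ← sq_abs q, e3]
  have hss : s⁻¹ * s = 1 := inv_mul_cancel₀ hs.ne'
  -- The weighted AM–GM inequality behind the interpolation: the cross term of this square is `2 *
  -- |q| ^ 3`.
  have h0 := sq_nonneg (s⁻¹ * |q| - s * |q| ^ 2)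
  have h1 : (s⁻¹ * |q| - s * |q| ^ 2) ^ 2
      = s⁻¹ ^ 2 * |q| ^ 2 + s ^ 2 * |q| ^ 4 - 2 * (s⁻¹ * s) * |q| ^ 3 := by ring
  rw [h1, hss] at h0
  have : 0 ≤ |q| ^ 3 := by positivity
  linarith

/-- Summability forces `p (u + 1) → 1/2`, so the cubic expansion holds for all but finitely many
sites. -/
lemma exists_potential_approx {p : ℕ → ℝ} (hs : Summable fun u : ℕ => |p (u + 1) - 1 / 2| ^ 3) :
    ∃ C : ℝ, ∀ y, |potential p y + 4 * ∑ u ∈ Finset.range y, (p (u + 1) - 1 / 2)| ≤ C := by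
  set e : ℕ → ℝ := fun u =>
    Real.log ((1 - p (u + 1)) / p (u + 1)) + 4 * (p (u + 1) - 1 / 2) with he
  have hsm : ∀ᶠ u : ℕ in atTop, |p (u + 1) - 1 / 2| ^ 3 < (1 / 4) ^ 3 :=
    hs.tendsto_atTop_zero.eventually_lt_const (by norm_num)
  have hse : Summable fun u => |e u| := by
    refine summable_abs_iff.2 (Summable.of_norm_bounded_eventually_nat (hs.mul_left 32) ?_)
    filter_upwards [hsm] with u hu
    have h := abs_log_ratio_add_le (lt_of_pow_lt_pow_left₀ 3 (by norm_num) hu).le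
    rw [show (1 : ℝ) / 2 - (p (u + 1) - 1 / 2) = 1 - p (u + 1) by ring,
      show (1 : ℝ) / 2 + (p (u + 1) - 1 / 2) = p (u + 1) by ring] at h
    exact h
  refine ⟨∑' u, |e u|, fun y => ?_⟩
  have : potential p y + 4 * ∑ u ∈ Finset.range y, (p (u + 1) - 1 / 2)
      = ∑ u ∈ Finset.range y, e u := by
    rw [potential, Finset.mul_sum, ← Finset.sum_add_distrib]
  rw [this]
  exact (Finset.abs_sum_le_sum_abs _ _).trans (hse.sum_le_tsum _ fun _ _ => abs_nonneg _)

/-- The potential splits into a bounded error, the centred sum, the mean drift and the gap between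
harmonic sum and logarithm; only the centred sum contributes to the slope error. -/
lemma ae_logPotential (hΔ : 0 < Δ) {δ : ℝ} (hδ : 0 < δ) :
    ∀ᵐ p ∂envMeasure (powerWeight 1) Δ, ∃ C, LogPotential p (Δ - 1) δ C := by
  obtain ⟨K, hK0, hK⟩ := exists_integral_sq_le hΔ
  obtain ⟨L, hL⟩ := exists_abs_mean_le hΔ
  set M : ℕ → ℝ := fun u => ∫ x, (x - 1 / 2) ∂siteMeasure (powerWeight 1) Δ (u + 1) with hM
  -- Bounding `±θ * S` by `θ ^ 2 * K * H + C` and dividing by `θ` leaves slope `θ * K`; this choice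
  -- makes `4 * θ * K ≤ δ`.
  set θ : ℝ := min 1 (δ / (4 * (K + 1))) with hθ
  have hθ0 : 0 < θ := lt_min one_pos (by positivity)
  have hθ1 : |θ| ≤ 1 := by rw [abs_of_pos hθ0]; exact min_le_left _ _
  have hθK : 4 * (θ * K) ≤ δ := by
    have h1 : θ ≤ δ / (4 * (K + 1)) := min_le_right _ _
    rw [le_div_iff₀ (by positivity)] at h1
    nlinarith
  have hLs : Summable fun u : ℕ => |-4 * M u - (Δ - 1) * (1 / ((u : ℝ) + 1))| := by
    have hb : Summable fun u : ℕ => L * (1 / ((u : ℝ) + 1) ^ 2) := by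
      have := (summable_nat_add_iff 1).2 (Real.summable_one_div_nat_pow.2 one_lt_two)
      simpa using this.mul_left L
    exact Summable.of_nonneg_of_le (fun _ => abs_nonneg _) hL hb
  filter_upwards [ae_summable_abs_cube hΔ, ae_sum_centred_le hΔ hK hθ1,
    ae_sum_centred_le hΔ hK (θ := -θ) (by rwa [abs_neg])] with p h1 h2 h3
  obtain ⟨C1, hC1⟩ := exists_potential_approx h1
  obtain ⟨C2, hC2⟩ := h2
  obtain ⟨C3, hC3⟩ := h3
  set C4 := ∑' u : ℕ, |-4 * M u - (Δ - 1) * (1 / ((u : ℝ) + 1))|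
  refine ⟨C1 + 4 * (θ * K + |C2| / θ + |C3| / θ) + C4 + |Δ - 1|, fun y => ?_⟩
  set H := ∑ u ∈ Finset.range y, 1 / ((u : ℝ) + 1)
  set S := ∑ u ∈ Finset.range y, (p (u + 1) - 1 / 2 - M u) with hS
  have hH := abs_harmonic_sub_log_le y
  have hS2 : |S| ≤ θ * K * H + |C2| / θ + |C3| / θ := by
    have a2 : θ * S ≤ θ ^ 2 * K * H + C2 := hC2 y
    have a3 : -θ * S ≤ (-θ) ^ 2 * K * H + C3 := hC3 y
    have b2 := le_abs_self C2
    have b3 := le_abs_self C3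
    have b4 := abs_nonneg C2
    have b5 := abs_nonneg C3
    have e : θ * (θ * K * H + |C2| / θ + |C3| / θ) = θ ^ 2 * K * H + |C2| + |C3| := by
      field_simp
    refine abs_le.2 ⟨?_, ?_⟩
    · refine le_of_mul_le_mul_left ?_ hθ0
      linarith
    · refine le_of_mul_le_mul_left ?_ hθ0
      linarith
  have hMs : |∑ u ∈ Finset.range y, (-4 * M u) - (Δ - 1) * H| ≤ C4 := by
    rw [Finset.mul_sum, ← Finset.sum_sub_distrib]
    exact (Finset.abs_sum_le_sum_abs _ _).trans (hLs.sum_le_tsum _ fun _ _ => abs_nonneg _)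
  have hsplit : potential p y - (Δ - 1) * Real.log (y + 1)
      = (potential p y + 4 * ∑ u ∈ Finset.range y, (p (u + 1) - 1 / 2)) - 4 * S
        + (∑ u ∈ Finset.range y, (-4 * M u) - (Δ - 1) * H)
        + (Δ - 1) * (H - Real.log (y + 1)) := by
    have hS' : S = ∑ u ∈ Finset.range y, (p (u + 1) - 1 / 2) - ∑ u ∈ Finset.range y, M u :=
      Finset.sum_sub_distrib _ _
    rw [hS', ← Finset.mul_sum]
    ring
  have hκ : |(Δ - 1) * (H - Real.log (y + 1))| ≤ |Δ - 1| := by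
    rw [abs_mul]
    exact mul_le_of_le_one_right (abs_nonneg _) hH
  have hlog : 0 ≤ Real.log ((y : ℝ) + 1) := Real.log_nonneg (by linarith [(Nat.cast_nonneg y : (0 : ℝ) ≤ y)])
  have hθH : θ * K * H ≤ θ * K * (Real.log (y + 1) + 1) :=
    mul_le_mul_of_nonneg_left (by linarith [(abs_le.1 hH).2]) (by positivity)
  have hfin : 4 * (θ * K) * Real.log (y + 1) ≤ δ * Real.log (y + 1) :=
    mul_le_mul_of_nonneg_right hθK hlog
  have := abs_le.1 (hC1 y)
  have := abs_le.1 hS2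
  have := abs_le.1 hMs
  have := abs_le.1 hκ
  rw [hsplit, abs_le]
  constructor <;> linarith

end Env

/-! ### From levels reached to the growth of a path -/

section Deterministic

/-- A path that infinitely often reaches `x` by time `x ^ s` grows faster than `n ^ β` along a
subsequence if `β * s < 1`. -/
lemma limsup_eq_top_of_frequently_reachedBy {i : ℕ → ℕ} {s β : ℝ} (hs : 0 < s) (hβ : s * β < 1)
    (h : ∃ᶠ x : ℕ in atTop, i ∈ reachedBy x ⌈(x : ℝ) ^ s⌉₊) :
    limsup (fun n : ℕ => (((i n : ℝ) / (n : ℝ) ^ β : ℝ) : EReal)) atTop = ⊤ := by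
  -- The exponent `β` may be negative (when `ε > 1`); since `j ≥ 1`, it may be replaced by its
  -- positive part.
  set b := max β 0 with hb
  have hb0 : 0 ≤ b := le_max_right _ _
  have hsb : s * b < 1 := by
    rcases max_cases β 0 with ⟨h1, _⟩ | ⟨h1, _⟩
    · rw [hb, h1]; exact hβ
    · rw [hb, h1, mul_zero]; exact one_pos
  have key : ∀ B : ℝ, ∃ᶠ n : ℕ in atTop, B ≤ (i n : ℝ) / (n : ℝ) ^ β := by
    intro B
    have hgrow : Tendsto (fun x : ℕ => (2 : ℝ) ^ (-b) * (x : ℝ) ^ (1 - s * b)) atTop atTop :=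
      (((tendsto_rpow_atTop (by linarith)).comp tendsto_natCast_atTop_atTop).const_mul_atTop
        (by positivity))
    refine frequently_atTop.2 fun N => ?_
    -- A level above the sum of the first positions cannot be reached by time `N`, which forces `j >
    -- N`.
    obtain ⟨x, ⟨j, hj, hx⟩, hxB, hxm⟩ := (h.and_eventually ((hgrow.eventually_ge_atTop B).and
      (eventually_gt_atTop (∑ k ∈ Finset.range (N + 1), i k)))).exists
    have hNj : N < j := by
      by_contra hjN
      have := Finset.single_le_sum (f := i) (fun _ _ => Nat.zero_le _)
        (Finset.mem_range.2 (by omega : j < N + 1))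
      omega
    refine ⟨j, hNj.le, hxB.trans ?_⟩
    have hj0 : (0 : ℝ) < j := by exact_mod_cast (Nat.zero_le N).trans_lt hNj
    have hj1 : (1 : ℝ) ≤ j := by exact_mod_cast (Nat.zero_le N).trans_lt hNj
    have hx0 : (0 : ℝ) < x := by exact_mod_cast (Nat.zero_le _).trans_lt hxm
    have hx1 : (1 : ℝ) ≤ x := by exact_mod_cast (Nat.zero_le _).trans_lt hxm
    have hjx : (j : ℝ) ≤ 2 * (x : ℝ) ^ s := by
      have h1 : (j : ℝ) ≤ ⌈(x : ℝ) ^ s⌉₊ := by exact_mod_cast hj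
      have h2 := Nat.ceil_lt_add_one (by positivity : 0 ≤ (x : ℝ) ^ s)
      have h3 := Real.one_le_rpow hx1 hs.le
      linarith
    have hjb : (j : ℝ) ^ β ≤ 2 ^ b * (x : ℝ) ^ (s * b) := by
      calc (j : ℝ) ^ β ≤ (j : ℝ) ^ b := Real.rpow_le_rpow_of_exponent_le hj1 (le_max_left _ _)
        _ ≤ (2 * (x : ℝ) ^ s) ^ b := Real.rpow_le_rpow hj0.le hjx hb0
        _ = _ := by rw [Real.mul_rpow (by norm_num) (by positivity), ← Real.rpow_mul hx0.le]
    calc (2 : ℝ) ^ (-b) * (x : ℝ) ^ (1 - s * b) = x / (2 ^ b * (x : ℝ) ^ (s * b)) := by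
          rw [Real.rpow_neg (by norm_num), Real.rpow_sub hx0, Real.rpow_one]
          field_simp
      _ ≤ x / (j : ℝ) ^ β := by gcongr
      _ ≤ (i j : ℝ) / (j : ℝ) ^ β := by gcongr
  rw [EReal.eq_top_iff_forall_lt]
  intro B
  have h1 : ((B + 1 : ℝ) : EReal)
      ≤ limsup (fun n : ℕ => (((i n : ℝ) / (n : ℝ) ^ β : ℝ) : EReal)) atTop :=
    le_limsup_of_frequently_le ((key (B + 1)).mono fun n hn => EReal.coe_le_coe_iff.2 hn)
  exact lt_of_lt_of_le (EReal.coe_lt_coe_iff.2 (by linarith)) h1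

/-- A path that does not reach `2 ^ (k + 1)` by time `2 ^ (k * s)`, for large `k`, grows slower
than `n ^ β` if `β * s > 1`. -/
lemma tendsto_zero_of_not_reachedBy {i : ℕ → ℕ} {s β : ℝ} (hs : 0 < s) (hβ : 1 < s * β) {K : ℕ}
    (h : ∀ k ≥ K, i ∉ reachedBy (2 * 2 ^ k) ⌊((2 : ℝ) ^ k) ^ s⌋₊) :
    Tendsto (fun n : ℕ => (i n : ℝ) / (n : ℝ) ^ β) atTop (𝓝 0) := by
  have hinv : 0 < s⁻¹ := inv_pos.2 hs
  have hexp : 0 < β - s⁻¹ := by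
    rw [sub_pos, inv_lt_iff_one_lt_mul₀ hs, mul_comm]; exact hβ
  have hlim : Tendsto (fun n : ℕ => 4 * (n : ℝ) ^ (-(β - s⁻¹))) atTop (𝓝 0) := by
    have := ((tendsto_rpow_neg_atTop hexp).comp tendsto_natCast_atTop_atTop).const_mul (4 : ℝ)
    simpa [Function.comp_def] using this
  have hlarge : ∀ᶠ n : ℕ in atTop, (2 : ℝ) ^ K ≤ (n : ℝ) ^ s⁻¹ :=
    ((tendsto_rpow_atTop hinv).comp tendsto_natCast_atTop_atTop).eventually_ge_atTop _
  refine squeeze_zero' (Eventually.of_forall fun n => by positivity) ?_ hlim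
  filter_upwards [hlarge, eventually_ge_atTop 1] with n hn hn1
  have hn0 : (0 : ℝ) < n := by exact_mod_cast hn1
  -- Here `2 ^ k ≤ n ^ (1/s) < 2 ^ (k + 1)`. The hypothesis is used at `k + 1`, whose time window
  -- contains `n`.
  obtain ⟨k, hk1, hk2⟩ := exists_nat_pow_near
    (Real.one_le_rpow (by exact_mod_cast hn1 : (1 : ℝ) ≤ n) hinv.le) one_lt_two
  have hKk : K ≤ k + 1 := ((pow_lt_pow_iff_right₀ one_lt_two).1 (hn.trans_lt hk2)).le
  have hle : n ≤ ⌊((2 : ℝ) ^ (k + 1)) ^ s⌋₊ := by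
    refine Nat.le_floor ?_
    calc (n : ℝ) = ((n : ℝ) ^ s⁻¹) ^ s := by
          rw [← Real.rpow_mul hn0.le, inv_mul_cancel₀ hs.ne', Real.rpow_one]
      _ ≤ _ := Real.rpow_le_rpow (by positivity) hk2.le hs.le
  have hi : i n < 2 * 2 ^ (k + 1) := by
    by_contra hc
    exact h (k + 1) hKk ⟨n, hle, not_lt.1 hc⟩
  have hi' : (i n : ℝ) ≤ 4 * (n : ℝ) ^ s⁻¹ := by
    have h1 : (i n : ℝ) < 2 * 2 ^ (k + 1) := by exact_mod_cast hi
    rw [pow_succ] at h1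
    linarith
  rw [div_le_iff₀ (by positivity), mul_assoc, ← Real.rpow_add hn0]
  ring_nf
  ring_nf at hi'
  exact hi'

end Deterministic

/-! ### Transfer from the environment to the reinforced walk -/

variable {Ω : Type*} [MeasurableSpace Ω] {P : Measure Ω} [IsProbabilityMeasure P] {Δ : ℝ}
  {X : ℕ → Ω → ℕ}

lemma max_sub_one_add_one (Δ : ℝ) : max (Δ - 1 + 1) 2 = max Δ 2 := by rw [sub_add_cancel]

lemma ae_tendsto_hitTime_div (hΔ : 0 < Δ) {s : ℝ} (hs : max Δ 2 < s) :
    ∀ᵐ p ∂envMeasure (powerWeight 1) Δ,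
      Tendsto (fun x : ℕ => hitTime p x / ⌈(x : ℝ) ^ s⌉₊) atTop (𝓝 0) := by
  -- The loss `3 * δ` of `hitTime_le` is then half the gap.
  set δ := (s - max Δ 2) / 6 with hδ
  have hδ0 : 0 < δ := by rw [hδ]; linarith
  filter_upwards [ae_logPotential hΔ hδ0, envMeasure_ae_isEnv (powerWeight_pos 1) hΔ]
    with p ⟨C, hC⟩ hp
  obtain ⟨K, hK⟩ := hitTime_le hp.1 hp.2 hδ0 hC
  rw [max_sub_one_add_one] at hK
  have hlim : Tendsto (fun x : ℕ => K * (x : ℝ) ^ (-(3 * δ))) atTop (𝓝 0) := by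
    have := ((tendsto_rpow_neg_atTop (by positivity : 0 < 3 * δ)).comp
      tendsto_natCast_atTop_atTop).const_mul K
    simpa [Function.comp_def] using this
  refine squeeze_zero' (Eventually.of_forall fun x =>
    div_nonneg (hp.1.hitTime_nonneg x) (Nat.cast_nonneg _)) ?_ hlim
  filter_upwards [eventually_ge_atTop 1] with x hx
  have hx0 : (0 : ℝ) < x := by exact_mod_cast hx
  have hxs : 0 < (x : ℝ) ^ s := Real.rpow_pos_of_pos hx0 s
  calc hitTime p x / ⌈(x : ℝ) ^ s⌉₊ ≤ hitTime p x / (x : ℝ) ^ s :=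
        div_le_div_of_nonneg_left (hp.1.hitTime_nonneg x) hxs (Nat.le_ceil _)
    _ ≤ K * (x : ℝ) ^ (max Δ 2 + 3 * δ) / (x : ℝ) ^ s := by gcongr; exact hK x
    _ = K * (x : ℝ) ^ (-(3 * δ)) := by
        rw [mul_div_assoc, ← Real.rpow_sub hx0]
        congr 2
        rw [hδ]; ring

/-- Bounded convergence over the environment turns almost sure quenched limits into annealed ones,
with no rate needed. -/
lemma measureReal_path_tendsto_zero (hΔ : 0 < Δ) (hX : IsLERRW P 1 Δ X) {A : ℕ → Set (ℕ → ℕ)}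
    {N : ℕ → ℕ} (hA : ∀ n, DependsUpTo (A n) (N n))
    (hlim : ∀ᵐ p ∂envMeasure (powerWeight 1) Δ, Tendsto
      (fun n => pathMean (quenched p) ((A n).indicator 1) (N n) 0 0) atTop (𝓝 0)) :
    Tendsto (fun n => P.real {ω | (fun k => X k ω) ∈ A n}) atTop (𝓝 0) := by
  have hw := powerWeight_pos 1
  have := isProbabilityMeasure_envMeasure hw hΔ
  simp only [fun n => measureReal_path_eq_integral hw hΔ hX (hA n)]
  rw [← integral_zero (ℕ → ℝ) ℝ (μ := envMeasure (powerWeight 1) Δ)]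
  refine tendsto_integral_of_dominated_convergence (fun _ => 1)
    (fun n => (measurable_pathMean _ _ _ _).aestronglyMeasurable) (integrable_const 1)
    (fun n => ?_) hlim
  filter_upwards [envMeasure_ae_isEnv hw hΔ] with p hp
  have h := pathMean_mem_Icc (q := quenched p) hp.1.quenched_mem_Icc
    (indicator_one_mem_Icc (A n)) (N n) 0 0
  rw [Real.norm_of_nonneg h.1]
  exact h.2

lemma ae_frequently_reachedBy (hΔ : 0 < Δ) (hX : IsLERRW P 1 Δ X) {s : ℝ} (hs : max Δ 2 < s) :
    ∀ᵐ ω ∂P, ∃ᶠ x : ℕ in atTop, (fun k => X k ω) ∈ reachedBy x ⌈(x : ℝ) ^ s⌉₊ := by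
  have hlim := measureReal_path_tendsto_zero hΔ hX
    (fun x => (dependsUpTo_reachedBy (x := x) (le_refl ⌈(x : ℝ) ^ s⌉₊)).compl) (by
      filter_upwards [ae_tendsto_hitTime_div hΔ hs,
        envMeasure_ae_isEnv (powerWeight_pos 1) hΔ] with p hp henv
      refine squeeze_zero' (Eventually.of_forall fun x => (pathMean_mem_Icc (q := quenched p)
        henv.1.quenched_mem_Icc (indicator_one_mem_Icc _) _ _ _).1) ?_ hp
      filter_upwards [eventually_ge_atTop 1] with x hx
      refine henv.1.pathMean_not_reachedBy (Nat.ceil_pos.2 ?_).ne'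
      exact Real.rpow_pos_of_pos (by exact_mod_cast hx) s)
  -- Failure at every `x ≥ K` is at most as likely as failure at a single large `x`, which has
  -- vanishing probability; no independence is required.
  have hnull : ∀ K : ℕ, P {ω | ∀ x ≥ K, (fun k => X k ω) ∈ (reachedBy x ⌈(x : ℝ) ^ s⌉₊)ᶜ} = 0 := by
    intro K
    rw [← measureReal_eq_zero_iff]
    refine le_antisymm (ge_of_tendsto hlim ?_) measureReal_nonneg
    filter_upwards [eventually_ge_atTop K] with x hx
    exact measureReal_mono fun ω hω => hω x hx
  have hall : ∀ᵐ ω ∂P, ∀ K : ℕ, ¬ ∀ x ≥ K, (fun k => X k ω) ∈ (reachedBy x ⌈(x : ℝ) ^ s⌉₊)ᶜ :=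
    ae_all_iff.2 fun K => by
      rw [ae_iff]
      simpa only [not_not] using hnull K
  filter_upwards [hall] with ω hω
  refine frequently_atTop.2 fun K => ?_
  have := hω K
  push Not at this
  obtain ⟨x, hx, h⟩ := this
  exact ⟨x, hx, not_not.1 h⟩

lemma ae_summable_div_hitTime (hΔ : 0 < Δ) {s : ℝ} (hs : s < max Δ 2) :
    ∀ᵐ p ∂envMeasure (powerWeight 1) Δ,
      Summable fun k : ℕ => (⌊((2 : ℝ) ^ k) ^ s⌋₊ : ℝ) / hitTime p (2 * 2 ^ k) := by
  -- The loss `2 * δ` of `hitTime_ge` is at most half the gap; the cap at `1` meets its hypothesis.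
  set δ := min 1 ((max Δ 2 - s) / 4) with hδ
  have hδ0 : 0 < δ := lt_min one_pos (by linarith)
  have hδ1 : δ ≤ 1 := min_le_left _ _
  have hδ2 : δ ≤ (max Δ 2 - s) / 4 := min_le_right _ _
  filter_upwards [ae_logPotential hΔ hδ0, envMeasure_ae_isEnv (powerWeight_pos 1) hΔ]
    with p ⟨C, hC⟩ hp
  obtain ⟨c, hc, hge⟩ := hitTime_ge hp.1 hp.2 hδ0 hδ1 (by linarith) hC
  rw [max_sub_one_add_one] at hge
  set τ := s - (max Δ 2 - 2 * δ) with hτ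
  have hτ0 : τ < 0 := by rw [hτ]; linarith
  have hgeo : Summable fun k : ℕ => c⁻¹ * ((2 : ℝ) ^ τ) ^ k :=
    (summable_geometric_of_lt_one (by positivity)
      (Real.rpow_lt_one_of_one_lt_of_neg one_lt_two hτ0)).mul_left _
  refine Summable.of_nonneg_of_le (fun k => div_nonneg (Nat.cast_nonneg _)
    (hp.1.hitTime_nonneg _)) (fun k => ?_) hgeo
  have h2 : (0 : ℝ) < 2 ^ k := by positivity
  have h := hge (2 ^ k) (by positivity)
  push_cast at h
  calc (⌊((2 : ℝ) ^ k) ^ s⌋₊ : ℝ) / hitTime p (2 * 2 ^ k)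
      ≤ ((2 : ℝ) ^ k) ^ s / (c * ((2 : ℝ) ^ k) ^ (max Δ 2 - 2 * δ)) := by
        gcongr
        exact Nat.floor_le (by positivity)
    _ = c⁻¹ * ((2 : ℝ) ^ τ) ^ k := by
        rw [← Real.rpow_natCast ((2 : ℝ) ^ τ), ← Real.rpow_mul (by norm_num), mul_comm τ,
          Real.rpow_mul (by norm_num), Real.rpow_natCast, hτ, Real.rpow_sub h2 s (max Δ 2 - 2 * δ)]
        field_simp

/-- Borel–Cantelli is run inside the environment, because the sums of quenched bounds are finite
almost surely but not controlled in mean. The tails tend to `0`, and bounded convergence makes the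
annealed probabilities of tail unions tend to `0`. -/
lemma ae_eventually_not_reachedBy (hΔ : 0 < Δ) (hX : IsLERRW P 1 Δ X) {s : ℝ}
    (hs : s < max Δ 2) :
    ∀ᵐ ω ∂P, ∃ K : ℕ, ∀ k ≥ K,
      (fun n => X n ω) ∉ reachedBy (2 * 2 ^ k) ⌊((2 : ℝ) ^ k) ^ s⌋₊ := by
  set n : ℕ → ℕ := fun k => ⌊((2 : ℝ) ^ k) ^ s⌋₊ with hn
  set U : ℕ → ℕ → Set (ℕ → ℕ) := fun K M =>
    ⋃ k ∈ Finset.Ico K M, reachedBy (2 * 2 ^ k) (n k) with hU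
  set S : ℕ → ℕ → Set Ω := fun K M => {ω | (fun k => X k ω) ∈ U K M} with hS
  have hnle : ∀ K M, ∀ k ∈ Finset.Ico K M, n k ≤ ∑ l ∈ Finset.range M, n l := fun K M k hk =>
    Finset.single_le_sum (fun _ _ => Nat.zero_le _)
      (Finset.mem_range.2 (Finset.mem_Ico.1 hk).2)
  have hdep : ∀ K M, DependsUpTo (U K M) (∑ l ∈ Finset.range M, n l) := fun K M i j hij hi => by
    obtain ⟨k, hk, h⟩ := Set.mem_iUnion₂.1 hi
    exact Set.mem_iUnion₂.2 ⟨k, hk, dependsUpTo_reachedBy (hnle K M k hk) i j hij h⟩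
  have hlim : ∀ M : ℕ → ℕ, Tendsto (fun K => P.real (S K (M K))) atTop (𝓝 0) := fun M =>
    measureReal_path_tendsto_zero hΔ hX (fun K => hdep K (M K)) (by
      filter_upwards [ae_summable_div_hitTime hΔ hs,
        envMeasure_ae_isEnv (powerWeight_pos 1) hΔ] with p hp henv
      have htail := tendsto_sum_nat_add fun k => (n k : ℝ) / hitTime p (2 * 2 ^ k)
      refine squeeze_zero (fun K => (pathMean_mem_Icc (q := quenched p)
        henv.1.quenched_mem_Icc (indicator_one_mem_Icc _) _ _ _).1) (fun K => ?_) htail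
      refine (henv.1.pathMean_iUnion_reachedBy (Finset.Ico K (M K)) (fun k => 2 * 2 ^ k) n
        (fun k _ => by positivity) (hnle K (M K))).trans ?_
      rw [Finset.sum_Ico_eq_sum_range]
      simp only [add_comm K]
      exact ((summable_nat_add_iff K).2 hp).sum_le_tsum _ fun k _ =>
        div_nonneg (Nat.cast_nonneg _) (henv.1.hitTime_nonneg _))
  have hmono : ∀ K, Monotone (S K) := fun K M M' hM ω hω => by
    obtain ⟨k, hk, h⟩ := Set.mem_iUnion₂.1 hω
    exact Set.mem_iUnion₂.2 ⟨k, Finset.Ico_subset_Ico_right hM hk, h⟩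
  -- The mixture formula covers only events of finitely many steps, so each infinite union is cut at
  -- a level losing at most `1 / (K + 1)`.
  have hex : ∀ K, ∃ M, P.real (⋃ M, S K M) ≤ P.real (S K M) + 1 / ((K : ℝ) + 1) := fun K => by
    have ht : Tendsto (fun M => P.real (S K M)) atTop (𝓝 (P.real (⋃ M, S K M))) :=
      (ENNReal.tendsto_toReal (measure_ne_top _ _)).comp
        (tendsto_measure_iUnion_atTop (hmono K))
    have hpos : 0 < 1 / ((K : ℝ) + 1) := by positivity
    obtain ⟨M, hM⟩ := (ht.eventually (lt_mem_nhds (sub_lt_self _ hpos))).exists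
    exact ⟨M, by linarith⟩
  choose M hM using hex
  have hlim' : Tendsto (fun K => P.real (S K (M K)) + 1 / ((K : ℝ) + 1)) atTop (𝓝 0) := by
    simpa using (hlim M).add tendsto_one_div_add_atTop_nhds_zero_nat
  have hnull : P (⋂ K, ⋃ M, S K M) = 0 := by
    rw [← measureReal_eq_zero_iff]
    refine le_antisymm (ge_of_tendsto hlim' (Eventually.of_forall fun K => ?_)) measureReal_nonneg
    exact (measureReal_mono (Set.iInter_subset _ K)).trans (hM K)
  have hae : ∀ᵐ ω ∂P, ω ∉ ⋂ K, ⋃ M, S K M := measure_eq_zero_iff_ae_notMem.1 hnull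
  filter_upwards [hae] with ω hω
  simp only [Set.mem_iInter, not_forall] at hω
  obtain ⟨K, hK⟩ := hω
  refine ⟨K, fun k hk h => hK (Set.mem_iUnion.2 ⟨k + 1, Set.mem_iUnion₂.2 ⟨k, ?_, h⟩⟩)⟩
  exact Finset.mem_Ico.2 ⟨hk, Nat.lt_succ_self k⟩

lemma IsLERRW.ae_growth (hΔ : 0 < Δ) (hX : IsLERRW P 1 Δ X) {ε : ℝ} (hε : 0 < ε) :
    ∀ᵐ ω ∂P,
      limsup (fun n : ℕ => (((X n ω : ℝ) / (n : ℝ) ^ ((1 - ε) / max Δ 2) : ℝ) : EReal))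
        atTop = ⊤ ∧
      Tendsto (fun n : ℕ => (X n ω : ℝ) / (n : ℝ) ^ ((1 + ε) / max Δ 2)) atTop (𝓝 0) := by
  have hγ : 0 < max Δ 2 := lt_max_of_lt_left hΔ
  -- With these two values of `s`, the products `s * β` are `1 - ε ^ 2 < 1` and `(1 + ε) / (1 + ε /
  -- 2) > 1`.
  have h1 : max Δ 2 < max Δ 2 * (1 + ε) := by nlinarith
  have h2 : max Δ 2 / (1 + ε / 2) < max Δ 2 := by
    rw [div_lt_iff₀ (by positivity)]; nlinarith
  filter_upwards [ae_frequently_reachedBy hΔ hX h1, ae_eventually_not_reachedBy hΔ hX h2]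
    with ω hω1 ⟨K, hK⟩
  refine ⟨limsup_eq_top_of_frequently_reachedBy (by positivity) ?_ hω1,
    tendsto_zero_of_not_reachedBy (by positivity) ?_ hK⟩
  · rw [mul_right_comm, mul_div_cancel₀ _ hγ.ne']
    nlinarith
  · rw [div_mul_div_comm, mul_comm (max Δ 2), mul_div_mul_right _ _ hγ.ne', one_lt_div (by positivity)]
    linarith

end LERRW

theorem theorem2p3 {Ω : Type*} [MeasurableSpace Ω]
    (P : MeasureTheory.Measure Ω) [MeasureTheory.IsProbabilityMeasure P]
    (Δ : ℝ) (hΔ : 0 < Δ) (X : ℕ → Ω → ℕ) (hX : LERRW.IsLERRW P 1 Δ X) :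
    (2 < Δ → ∀ ε : ℝ, 0 < ε → ∀ᵐ ω ∂P,
      Filter.limsup (fun n : ℕ => (((X n ω : ℝ) / (n : ℝ) ^ ((1 - ε) / Δ) : ℝ) : EReal))
        Filter.atTop = ⊤ ∧
      Filter.Tendsto (fun n : ℕ => (X n ω : ℝ) / (n : ℝ) ^ ((1 + ε) / Δ))
        Filter.atTop (nhds 0)) ∧
    (Δ ≤ 2 → ∀ ε : ℝ, 0 < ε → ∀ᵐ ω ∂P,
      Filter.limsup (fun n : ℕ => (((X n ω : ℝ) / (n : ℝ) ^ ((1 - ε) / 2) : ℝ) : EReal))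
        Filter.atTop = ⊤ ∧
      Filter.Tendsto (fun n : ℕ => (X n ω : ℝ) / (n : ℝ) ^ ((1 + ε) / 2))
        Filter.atTop (nhds 0)) := by
  refine ⟨fun h ε hε => ?_, fun h ε hε => ?_⟩
  · have := LERRW.IsLERRW.ae_growth hΔ hX hε
    rwa [max_eq_left h.le] at this
  · have := LERRW.IsLERRW.ae_growth hΔ hX hε
    rwa [max_eq_right h] at this
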